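/- Let $\mathbb K$ be an algebraically closed field of characteristic $0$. A Hom-Lie algebra $(\mathfrak g,[\cdot,\cdot],\alpha)$ is a $\mathbb K$-vector space with a skew-symmetric bilinear bracket and a linear map $\alpha$ such that $[\alpha(x),[y,z]]+[\alpha(y),[z,x]]+[\alpha(z),[x,y]]=0$ for all $x,y,z$. It is multiplicative if $\alpha([x,y])=[\alpha(x),\alpha(y)]$ for all $x,y$. Put $C^0(\mathfrak g)=\mathfrak g$, $C^{k+1}(\mathfrak g)=[\mathfrak g,C^k(\mathfrak g)]$. If $\dim\mathfrak g=m$, it is filiform if it is nilpotent, $\alpha(C^k(\mathfrak g))\subseteq C^k(\mathfrak g)$ for all $k$, and $\dim C^k(\mathfrak g)=m-k-1$ for $1\le k\le m-1$. Let $C_q^p\in\mathbb K$ ($p,q\in\mathbb Z$) be parameters with $C_0^0=1$ and $C_q^p=0$ for $q<p$, and put $c=C_1^0$, $d=C_1^1$. On $\mathbb K^{n+1}$ with basis $x_0,\dots,x_n$ (and $x_l=0$ for $l>n$), let $\mu_0$ be the skew-symmetric bilinear map with $\mu_0(x_0,x_i)=x_{i+1}$ for $1\le i\le n-1$, and let $\psi_{k,r}$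 be the skew-symmetric bilinear map with $\psi_{k,r}(x_i,x_j)=(-1)^{k-i}C_{j-k-1}^{k-i}\,x_{i+j+r-2k-1}$ for $1\le i\le k\le j\le n$, $i<j$; all other values on pairs $(x_i,x_j)$, $i<j$, are zero. For each bracket $\mu$ below on $\mathbb K^m$, $m=n+1$, and each $m\times m$ matrix $A$ over $\mathbb K$, defining $\alpha$ by letting column $i$ of $A$ be the coordinates of $\alpha(x_i)$, the following are equivalent: (i) $A$ is lower triangular and $(\mathbb K^m,\mu,\alpha)$ is a multiplicative filiform Hom-Lie algebra; (ii) $A$ belongs to at least one of the families listed for $\mu$, for some values $\rho_{ij}\in\mathbb K$ of the parameters that occur in it, subject to the conditions stated with the family. **$m=3$, $\mu=\mu_0$:** (1) $$\begin{pmatrix}\rho_{00} & 0 & 0\\ \rho_{01} & \rho_{11} & 0\\ \rho_{02} & \rho_{12} & \rho_{00}\,\rho_{11}\end{pmatrix}$$ (2) $$\begin{pmatrix}0 & 0 & 0\\ \rho_{01} & \rho_{11} & 0\\ \rho_{02} & \rho_{12} & 0\end{pmatrix}$$ **$m=4$, $\mu=\mu_0$:** (1) $$\begin{pmatrix}\rho_{00}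 & 0 & 0 & 0\\ \rho_{01} & \rho_{22}/\rho_{00} & 0 & 0\\ \rho_{02} & \rho_{12} & \rho_{22} & 0\\ \rho_{03} & \rho_{13} & \rho_{12}\,\rho_{00} & \rho_{00}\,\rho_{22}\end{pmatrix}$$ with $\rho_{00} \neq 0$ (2) $$\begin{pmatrix}0 & 0 & 0 & 0\\ \rho_{01} & \rho_{11} & 0 & 0\\ \rho_{02} & \rho_{12} & 0 & 0\\ \rho_{03} & \rho_{13} & 0 & 0\end{pmatrix}$$ **$m=5$, $\mu=\mu_0$:** (1) $$\begin{pmatrix}\rho_{00} & 0 & 0 & 0 & 0\\ \rho_{01} & \rho_{22}/\rho_{00} & 0 & 0 & 0\\ \rho_{02} & \rho_{23}/\rho_{00} & \rho_{22} & 0 & 0\\ \rho_{03} & \rho_{13} & \rho_{23} & \rho_{00}\,\rho_{22} & 0\\ \rho_{04} & \rho_{14} & \rho_{00}\,\rho_{13} & \rho_{00}\,\rho_{23} & \rho_{00}^{2}\,\rho_{22}\end{pmatrix}$$ with $\rho_{00} \neq 0$ (2) $$\begin{pmatrix}0 & 0 & 0 & 0 & 0\\ \rho_{01} & \rho_{11}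 & 0 & 0 & 0\\ \rho_{02} & \rho_{12} & 0 & 0 & 0\\ \rho_{03} & \rho_{13} & 0 & 0 & 0\\ \rho_{04} & \rho_{14} & 0 & 0 & 0\end{pmatrix}$$ **$m=5$, $\mu=\mu_0+\psi_{1,4}$:** (1) $$\begin{pmatrix}0 & 0 & 0 & 0 & 0\\ \rho_{01} & \rho_{11} & 0 & 0 & 0\\ \rho_{02} & \rho_{12} & 0 & 0 & 0\\ \rho_{03} & \rho_{13} & 0 & 0 & 0\\ \rho_{04} & \rho_{14} & -(\rho_{11}\,\rho_{02}) + \rho_{12}\,\rho_{01} & 0 & 0\end{pmatrix}$$ (2) $$\begin{pmatrix}\rho_{00} & 0 & 0 & 0 & 0\\ \rho_{01} & 0 & 0 & 0 & 0\\ \rho_{02} & \rho_{12} & 0 & 0 & 0\\ \rho_{03} & \rho_{13} & \rho_{00}\,\rho_{12} & 0 & 0\\ \rho_{04} & \rho_{14} & \rho_{01}\,\rho_{12} + \rho_{00}\,\rho_{13} & \rho_{00}^{2}\,\rho_{12} & 0\end{pmatrix}$$ (3) $$\begin{pmatrix}\rho_{00} & 0 & 0 & 0 & 0\\ \rho_{01}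 & \rho_{00}^{2} & 0 & 0 & 0\\ \rho_{02} & \rho_{12} & \rho_{00}^{3} & 0 & 0\\ \rho_{03} & \rho_{13} & \rho_{00}\,\rho_{12} & \rho_{00}^{4} & 0\\ \rho_{04} & \rho_{14} & \rho_{01}\,\rho_{12} + \rho_{00}\,\rho_{13} - \rho_{00}^{2}\,\rho_{02} & \rho_{00}^{2}\,(\rho_{00}\,\rho_{01} + \rho_{12}) & \rho_{00}^{5}\end{pmatrix}$$ **$m=6$, $\mu=\mu_0$:** (1) $$\begin{pmatrix}\rho_{00} & 0 & 0 & 0 & 0 & 0\\ \rho_{01} & \rho_{22}/\rho_{00} & 0 & 0 & 0 & 0\\ \rho_{02} & \rho_{23}/\rho_{00} & \rho_{22} & 0 & 0 & 0\\ \rho_{03} & \rho_{24}/\rho_{00} & \rho_{23} & \rho_{00}\,\rho_{22} & 0 & 0\\ \rho_{04} & \rho_{14} & \rho_{24} & \rho_{23}\,\rho_{00} & \rho_{22}\,\rho_{00}^{2} & 0\\ \rho_{05} & \rho_{15} & \rho_{14}\,\rho_{00} & \rho_{24}\,\rho_{00} & \rho_{23}\,\rho_{00}^{2} & \rho_{00}^{3}\,\rho_{22}\end{pmatrix}$$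 with $\rho_{00} \neq 0$ (2) $$\begin{pmatrix}0 & 0 & 0 & 0 & 0 & 0\\ \rho_{01} & \rho_{11} & 0 & 0 & 0 & 0\\ \rho_{02} & \rho_{12} & 0 & 0 & 0 & 0\\ \rho_{03} & \rho_{13} & 0 & 0 & 0 & 0\\ \rho_{04} & \rho_{14} & 0 & 0 & 0 & 0\\ \rho_{05} & \rho_{15} & 0 & 0 & 0 & 0\end{pmatrix}$$ **$m=6$, $\mu=\mu_0+\psi_{1,4}+\psi_{2,5}$ with $d=0$ (here and in the next item $s\in\mathbb K$ is any fixed element with $s^2=5$):** (1) $$\begin{pmatrix}0 & 0 & 0 & 0 & 0 & 0\\ \rho_{01} & \rho_{11} & 0 & 0 & 0 & 0\\ \rho_{02} & -(c\,\rho_{11}) & 0 & 0 & 0 & 0\\ \rho_{03} & \rho_{13} & 0 & 0 & 0 & 0\\ \rho_{04} & \rho_{14} & -(\rho_{11}\,(c\,\rho_{01} + \rho_{02})) & 0 & 0 & 0\\ \rho_{05} & \rho_{15} & \rho_{13}\,(c\,\rho_{01} + \rho_{02}) & 0 & 0 & 0\end{pmatrix}$$ (2) $$\begin{pmatrix}-(1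 + s)/2 & 0 & 0 & 0 & 0 & 0\\ \rho_{01} & 0 & 0 & 0 & 0 & 0\\ \rho_{02} & (3 + s)/2 & 0 & 0 & 0 & 0\\ \rho_{03} & \rho_{13} & -2 - s & 0 & 0 & 0\\ \rho_{04} & \rho_{14} & ((3 + s)\,\rho_{01} - (1 + s)\,\rho_{13})/2 & (7 + 3\,s)/2 & 0 & 0\\ \rho_{05} & \rho_{15} & \rho_{25} & \rho_{35} & -(11 + 5\,s)/2 & 0\end{pmatrix}$$ with $\rho_{35} = ((3 + s)\,\rho_{13} - (4 + 2\,s)\,\rho_{02} - (4 + 2\,s)\,(c + 1)\,\rho_{01})/2$, $\rho_{25} = (-(3 + s)\,\rho_{03} + 2\,(c\,\rho_{01} + \rho_{02})\,\rho_{13} - (1 + s)\,\rho_{14})/2$ (3) $$\begin{pmatrix}-(1 - s)/2 & 0 & 0 & 0 & 0 & 0\\ \rho_{01} & 0 & 0 & 0 & 0 & 0\\ \rho_{02} & (3 - s)/2 & 0 & 0 & 0 & 0\\ \rho_{03} & \rho_{13} & -2 + s & 0 & 0 & 0\\ \rho_{04} & \rho_{14} & ((3 - s)\,\rho_{01} -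 (1 - s)\,\rho_{13})/2 & (7 - 3\,s)/2 & 0 & 0\\ \rho_{05} & \rho_{15} & \rho_{25} & \rho_{35} & -(11 - 5\,s)/2 & 0\end{pmatrix}$$ with $\rho_{35} = ((3 - s)\,\rho_{13} - (4 - 2\,s)\,\rho_{02} - (4 - 2\,s)\,(c + 1)\,\rho_{01})/2$, $\rho_{25} = (-(3 - s)\,\rho_{03} + 2\,(c\,\rho_{01} + \rho_{02})\,\rho_{13} - (1 - s)\,\rho_{14})/2$ **$m=6$, $\mu=\mu_0+\psi_{1,4}+\psi_{2,5}$ with $d\neq0$:** (1) $$\begin{pmatrix}0 & 0 & 0 & 0 & 0 & 0\\ \rho_{01} & 0 & 0 & 0 & 0 & 0\\ \rho_{02} & -(d\,\rho_{01}) & 0 & 0 & 0 & 0\\ \rho_{03} & \rho_{13} & 0 & 0 & 0 & 0\\ \rho_{04} & \rho_{14} & -(d\,\rho_{01}^{2}) & 0 & 0 & 0\\ \rho_{05} & \rho_{15} & (c\,\rho_{01} + \rho_{02})\,\rho_{13} + d\,\rho_{01}\,(\rho_{03} - \rho_{14}) & d^{2}\,\rho_{01}^{3} & 0 & 0\end{pmatrix}$$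 (2) $$\begin{pmatrix}d\,\rho_{01} & 0 & 0 & 0 & 0 & 0\\ \rho_{01} & 0 & 0 & 0 & 0 & 0\\ \rho_{02} & 0 & 0 & 0 & 0 & 0\\ \rho_{03} & \rho_{13} & 0 & 0 & 0 & 0\\ \rho_{04} & \rho_{14} & d\,\rho_{01}\,\rho_{13} & 0 & 0 & 0\\ \rho_{05} & \rho_{15} & (c\,\rho_{01} + \rho_{02})\,\rho_{13} & 0 & 0 & 0\end{pmatrix}$$ (3) $$\begin{pmatrix}\rho_{00} & 0 & 0 & 0 & 0 & 0\\ \rho_{01} & 0 & 0 & 0 & 0 & 0\\ \rho_{02} & \rho_{12} & 0 & 0 & 0 & 0\\ \rho_{03} & \rho_{13} & \rho_{00}\,\rho_{12} & 0 & 0 & 0\\ \rho_{04} & \rho_{14} & \rho_{24} & \rho_{00}^{2}\,\rho_{12} & 0 & 0\\ \rho_{05} & \rho_{15} & (\rho_{00} - d\,\rho_{01})\,\rho_{14} + (c\,\rho_{01} + \rho_{02})\,\rho_{13} - \rho_{03}\,\rho_{12} & (\rho_{00} - d\,\rho_{01})\,\rho_{24} + (c\,\rho_{01} + \rho_{02})\,(\rho_{00}\,\rho_{12})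 & \rho_{00}\,\rho_{12}^{2} & 0\end{pmatrix}$$ with $\rho_{00} = -(1 + s)/2$, $\rho_{12} = \rho_{00}\,(\rho_{00} - d\,\rho_{01})$, $\rho_{24} = \rho_{00}\,\rho_{13} + \rho_{01}\,\rho_{12}$ (4) $$\begin{pmatrix}\rho_{00} & 0 & 0 & 0 & 0 & 0\\ \rho_{01} & 0 & 0 & 0 & 0 & 0\\ \rho_{02} & \rho_{12} & 0 & 0 & 0 & 0\\ \rho_{03} & \rho_{13} & \rho_{00}\,\rho_{12} & 0 & 0 & 0\\ \rho_{04} & \rho_{14} & \rho_{24} & \rho_{00}^{2}\,\rho_{12} & 0 & 0\\ \rho_{05} & \rho_{15} & (\rho_{00} - d\,\rho_{01})\,\rho_{14} + (c\,\rho_{01} + \rho_{02})\,\rho_{13} - \rho_{03}\,\rho_{12} & (\rho_{00} - d\,\rho_{01})\,\rho_{24} + (c\,\rho_{01} + \rho_{02})\,(\rho_{00}\,\rho_{12}) & \rho_{00}\,\rho_{12}^{2} & 0\end{pmatrix}$$ with $\rho_{00} = -(1 - s)/2$, $\rho_{12} = \rho_{00}\,(\rho_{00} - d\,\rho_{01})$,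 $\rho_{24} = \rho_{00}\,\rho_{13} + \rho_{01}\,\rho_{12}$ (5) $$\begin{pmatrix}\rho_{00} & 0 & 0 & 0 & 0 & 0\\ \rho_{01} & \rho_{00}^{2} & 0 & 0 & 0 & 0\\ \rho_{02} & \rho_{12} & \rho_{00}^{3} & 0 & 0 & 0\\ \rho_{03} & \rho_{13} & \rho_{00}\,\rho_{12} & \rho_{00}^{4} & 0 & 0\\ \rho_{04} & \rho_{14} & \rho_{24} & \rho_{00}^{2}\,(1 - \rho_{00} + \rho_{12}) & \rho_{00}^{5} & 0\\ \rho_{05} & \rho_{15} & \rho_{00}^{2}\,(\rho_{14} - c\,\rho_{03} + \rho_{00}^{2}\,\rho_{04}) + (c\,\rho_{01} + \rho_{02})\,\rho_{13} - \rho_{03}\,\rho_{12} & \rho_{00}^{2}\,\rho_{24} + \rho_{00}\,\rho_{12}\,(c\,\rho_{01} + \rho_{02}) - \rho_{00}^{3}\,\rho_{03} & \rho_{45} & \rho_{00}^{7}\end{pmatrix}$$ with $\rho_{00}^{2} = d$, $\rho_{01} = (1 - \rho_{00})/\rho_{00}$, $(1 + \rho_{00})\,\rho_{12} = \rho_{00}^{2}\,(1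 - c)$, $\rho_{24} = \rho_{00}\,\rho_{13} + \rho_{01}\,\rho_{12} - \rho_{00}^{2}\,\rho_{02}$, $\rho_{45} = \rho_{00}\,(\rho_{12}^{2} + c\,\rho_{00}^{2}\,\rho_{12} - \rho_{00}^{3}\,\rho_{24} - \rho_{00}^{2}\,\rho_{13})$, $\rho_{45} = \rho_{00}^{4}\,(1 - \rho_{00} + \rho_{12} + c\,\rho_{01} + \rho_{02})$ **$m=6$, $\mu=\mu_0+\psi_{1,4}$ with $c\neq 0,1$:** (1) $$\begin{pmatrix}0 & 0 & 0 & 0 & 0 & 0\\ \rho_{01} & 0 & 0 & 0 & 0 & 0\\ \rho_{02} & \rho_{12} & 0 & 0 & 0 & 0\\ \rho_{03} & \rho_{13} & 0 & 0 & 0 & 0\\ \rho_{04} & \rho_{14} & \rho_{01}\,\rho_{12} & 0 & 0 & 0\\ \rho_{05} & \rho_{15} & c\,\rho_{01}\,\rho_{13} & 0 & 0 & 0\end{pmatrix}$$ (2) $$\begin{pmatrix}1/c & 0 & 0 & 0 & 0 & 0\\ \rho_{01} & 1/c^{2} & 0 & 0 & 0 & 0\\ \rho_{02} & (1 + c)\,\rho_{01}/((-1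 + c)\,c) & 1/c^{3} & 0 & 0 & 0\\ \rho_{03} & \rho_{13} & (1 + c)\,\rho_{01}/((-1 + c)\,c^{2}) & 1/c^{4} & 0 & 0\\ \rho_{04} & \rho_{14} & \rho_{24} & 2\,\rho_{01}/((-1 + c)\,c^{2}) & 1/c^{5} & 0\\ \rho_{05} & \rho_{15} & \rho_{25} & \rho_{35} & (1 + c)\,\rho_{01}/((-1 + c)\,c^{3}) & 1/c^{6}\end{pmatrix}$$ with $\rho_{35} = ((1 + c)\,\rho_{01}^{2} + (-1 + c)\,\rho_{24})/((-1 + c)\,c)$, $\rho_{25} = (-(\rho_{03}) + \rho_{14} + \rho_{13}\,\rho_{01}\,c^{2})/c$, $\rho_{02} = ((c^{2} - c^{3})\,\rho_{24} + c\,\rho_{01}^{2} + c^{2}\,\rho_{01}^{2} + c^{2}\,\rho_{13} - c\,\rho_{13})/(-1 + c)$ **$m=6$, $\mu=\mu_0+\psi_{1,4}$ with $c=1$:** (1) $$\begin{pmatrix}0 & 0 & 0 & 0 & 0 & 0\\ \rho_{01} & 0 & 0 & 0 & 0 & 0\\ \rho_{02} & \rho_{12} & 0 & 0 & 0 & 0\\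 \rho_{03} & \rho_{13} & 0 & 0 & 0 & 0\\ \rho_{04} & \rho_{14} & \rho_{01}\,\rho_{12} & 0 & 0 & 0\\ \rho_{05} & \rho_{15} & \rho_{01}\,\rho_{13} & 0 & 0 & 0\end{pmatrix}$$ (2) $$\begin{pmatrix}1 & 0 & 0 & 0 & 0 & 0\\ 0 & 1 & 0 & 0 & 0 & 0\\ \rho_{02} & \rho_{12} & 1 & 0 & 0 & 0\\ \rho_{03} & \rho_{13} & \rho_{12} & 1 & 0 & 0\\ \rho_{04} & \rho_{14} & \rho_{13} - \rho_{02} & \rho_{12} & 1 & 0\\ \rho_{05} & \rho_{15} & \rho_{14} - \rho_{03} & \rho_{13} - \rho_{02} & \rho_{12} & 1\end{pmatrix}$$ **$m=6$, $\mu=\mu_0+\psi_{1,5}$:** (1) $$\begin{pmatrix}\rho_{00} & 0 & 0 & 0 & 0 & 0\\ \rho_{01} & 0 & 0 & 0 & 0 & 0\\ \rho_{02} & \rho_{12} & 0 & 0 & 0 & 0\\ \rho_{03} & \rho_{24}/\rho_{00} & \rho_{00}\,\rho_{12} & 0 & 0 & 0\\ \rho_{04} & \rho_{14} & \rho_{24}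 & \rho_{12}\,\rho_{00}^{2} & 0 & 0\\ \rho_{05} & \rho_{15} & \rho_{12}\,\rho_{01} + \rho_{14}\,\rho_{00} & \rho_{24}\,\rho_{00} & \rho_{12}\,\rho_{00}^{3} & 0\end{pmatrix}$$ with $\rho_{00} \neq 0$ (2) $$\begin{pmatrix}0 & 0 & 0 & 0 & 0 & 0\\ \rho_{01} & \rho_{11} & 0 & 0 & 0 & 0\\ \rho_{02} & \rho_{12} & 0 & 0 & 0 & 0\\ \rho_{03} & \rho_{13} & 0 & 0 & 0 & 0\\ \rho_{04} & \rho_{14} & 0 & 0 & 0 & 0\\ \rho_{05} & \rho_{15} & -(\rho_{11}\,\rho_{02}) + \rho_{01}\,\rho_{12} & 0 & 0 & 0\end{pmatrix}$$ (3) $$\begin{pmatrix}\rho_{00} & 0 & 0 & 0 & 0 & 0\\ \rho_{01} & \rho_{00}^{3} & 0 & 0 & 0 & 0\\ \rho_{02} & \rho_{12} & \rho_{00}^{4} & 0 & 0 & 0\\ \rho_{03} & \rho_{24}/\rho_{00} & \rho_{00}\,\rho_{12} & \rho_{00}^{5} & 0 & 0\\ \rho_{04} & \rho_{14} & \rho_{24}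 & \rho_{00}^{2}\,\rho_{12} & \rho_{00}^{6} & 0\\ \rho_{05} & \rho_{15} & -(\rho_{00}^{3}\,\rho_{02}) + \rho_{14}\,\rho_{00} + \rho_{01}\,\rho_{12} & \rho_{00}\,(\rho_{00}^{3}\,\rho_{01} + \rho_{24}) & \rho_{00}^{3}\,\rho_{12} & \rho_{00}^{7}\end{pmatrix}$$ with $\rho_{00} \neq 0$ (4) $$\begin{pmatrix}\rho_{00} & 0 & 0 & 0 & 0 & 0\\ \rho_{01} & \rho_{00}^{3} & 0 & 0 & 0 & 0\\ \rho_{02} & \rho_{12} & \rho_{00}^{4} & 0 & 0 & 0\\ \rho_{03} & 0 & \rho_{00}\,\rho_{12} & \rho_{00}^{5} & 0 & 0\\ \rho_{04} & \rho_{14} & 0 & \rho_{00}^{2}\,\rho_{12} & \rho_{00}^{6} & 0\\ \rho_{05} & \rho_{15} & -(\rho_{00}^{3}\,\rho_{02}) + \rho_{14}\,\rho_{00} + \rho_{01}\,\rho_{12} & \rho_{00}^{4}\,\rho_{01} & \rho_{00}^{3}\,\rho_{12} & \rho_{00}^{7}\end{pmatrix}$$ (5) $$\begin{pmatrix}\rho_{00}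 & 0 & 0 & 0 & 0 & 0\\ \rho_{01} & 0 & 0 & 0 & 0 & 0\\ \rho_{02} & \rho_{12} & 0 & 0 & 0 & 0\\ \rho_{03} & 0 & \rho_{00}\,\rho_{12} & 0 & 0 & 0\\ \rho_{04} & \rho_{14} & 0 & \rho_{00}^{2}\,\rho_{12} & 0 & 0\\ \rho_{05} & \rho_{15} & \rho_{14}\,\rho_{00} + \rho_{01}\,\rho_{12} & 0 & \rho_{00}^{3}\,\rho_{12} & 0\end{pmatrix}$$ -/

import Mathlib

namespace HomLie

section General

variable {K V : Type*} [Field K] [AddCommGroup V] [Module K V]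

/-- `(V, μ, α)` is a Hom-Lie algebra: the bracket is skew-symmetric and satisfies the
Hom-Jacobi identity (the sum over cyclic permutations of `[α x, [y, z]]` is zero). -/
structure IsHomLie (μ : V →ₗ[K] V →ₗ[K] V) (α : V →ₗ[K] V) : Prop where
  skew : ∀ x y, μ x y = -μ y x
  hom_jacobi : ∀ x y z, μ (α x) (μ y z) + μ (α y) (μ z x) + μ (α z) (μ x y) = 0

/-- The structure map is multiplicative: `α [x, y] = [α x, α y]`. -/
def IsMultiplicative (μ : V →ₗ[K] V →ₗ[K] V) (α : V →ₗ[K] V) : Prop :=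
  ∀ x y, α (μ x y) = μ (α x) (α y)

/-- The terms `C⁰ = V`, `Cᵐ⁺¹ = [V, Cᵐ]`, the bracket of subspaces being the span of the
brackets of their elements. -/
def centralSeries (μ : V →ₗ[K] V →ₗ[K] V) : ℕ → Submodule K V
  | 0 => ⊤
  | m + 1 => Submodule.map₂ μ ⊤ (centralSeries μ m)

/-- `(V, μ, α)`, of finite dimension `n`, is filiform: the terms of the central series are
stable under `α`, the algebra is nilpotent, and `dim Cᵏ = n - k - 1` for `1 ≤ k ≤ n - 1`. -/
structure IsFiliform (μ : V →ₗ[K] V →ₗ[K] V) (α : V →ₗ[K] V) : Prop where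
  stable : ∀ m, (centralSeries μ m).map α ≤ centralSeries μ m
  nilpotent : ∃ m, centralSeries μ (m + 1) = ⊥ ∧ centralSeries μ m ≠ ⊥
  finrank_eq : ∀ k, 1 ≤ k → k + 1 ≤ Module.finrank K V →
    Module.finrank K (centralSeries μ k) + k + 1 = Module.finrank K V

/-- `(V, μ, α)` is a multiplicative filiform Hom-Lie algebra. -/
structure IsMultFiliformHomLie (μ : V →ₗ[K] V →ₗ[K] V) (α : V →ₗ[K] V) : Prop where
  isHomLie : IsHomLie μ α
  isFiliform : IsFiliform μ α
  isMultiplicative : IsMultiplicative μ α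

end General

section Brackets

variable {K : Type*} [Field K]

/-- The basis vector `x_m` of `K^(n+1)` with basis `x_0, …, x_n`; by convention `x_m = 0`
for `m > n`. -/
def basisVec (K : Type*) [Field K] (n m : ℕ) : Fin (n + 1) → K :=
  fun l => if (l : ℕ) = m then 1 else 0

/-- The skew-symmetric bilinear map on `K^(n+1)` whose value on `(x_i, x_j)`, for `i < j`, is
`f i j`. -/
def skewBracket {n : ℕ} (f : ℕ → ℕ → Fin (n + 1) → K) :
    (Fin (n + 1) → K) →ₗ[K] (Fin (n + 1) → K) →ₗ[K] (Fin (n + 1) → K) :=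
  LinearMap.mk₂ K
    (fun x y => ∑ i : Fin (n + 1), ∑ j : Fin (n + 1),
      if i < j then (x i * y j - x j * y i) • f i j else 0)
    (by
      intro x x' y
      simp only [← Finset.sum_add_distrib]
      refine Finset.sum_congr rfl fun i _ => Finset.sum_congr rfl fun j _ => ?_
      split_ifs
      · rw [← add_smul]; congr 1; simp only [Pi.add_apply]; ring
      · simp)
    (by
      intro c x y
      simp only [Finset.smul_sum]
      refine Finset.sum_congr rfl fun i _ => Finset.sum_congr rfl fun j _ => ?_
      split_ifs
      · rw [smul_smul]; congr 1; simp only [Pi.smul_apply, smul_eq_mul]; ring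
      · simp)
    (by
      intro x y y'
      simp only [← Finset.sum_add_distrib]
      refine Finset.sum_congr rfl fun i _ => Finset.sum_congr rfl fun j _ => ?_
      split_ifs
      · rw [← add_smul]; congr 1; simp only [Pi.add_apply]; ring
      · simp)
    (by
      intro c x y
      simp only [Finset.smul_sum]
      refine Finset.sum_congr rfl fun i _ => Finset.sum_congr rfl fun j _ => ?_
      split_ifs
      · rw [smul_smul]; congr 1; simp only [Pi.smul_apply, smul_eq_mul]; ring
      · simp)

/-- The bracket `μ₀` of the model filiform algebra `L_n`: `[x_0, x_i] = x_{i+1}` for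
`1 ≤ i ≤ n - 1`, the other brackets of basis vectors `x_i, x_j` with `i < j` being zero. -/
def mu0 (K : Type*) [Field K] (n : ℕ) :
    (Fin (n + 1) → K) →ₗ[K] (Fin (n + 1) → K) →ₗ[K] (Fin (n + 1) → K) :=
  skewBracket fun i j => if i = 0 ∧ 1 ≤ j ∧ j + 1 ≤ n then basisVec K n (j + 1) else 0

/-- The skew-symmetric cochain `ψ_{k,r}` on `K^(n+1)`:
`ψ_{k,r}(x_i, x_j) = (-1)^(k-i) C_{j-k-1}^{k-i} x_{i+j+r-2k-1}` for `1 ≤ i ≤ k ≤ j ≤ n`, and zero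
on the other pairs `x_i, x_j` with `i < j`. Here `C q p` stands for `C_q^p`. -/
def psi (C : ℤ → ℤ → K) (n k r : ℕ) :
    (Fin (n + 1) → K) →ₗ[K] (Fin (n + 1) → K) →ₗ[K] (Fin (n + 1) → K) :=
  skewBracket fun i j =>
    if 1 ≤ i ∧ i ≤ k ∧ k ≤ j ∧ j ≤ n then
      ((-1) ^ (k - i) * C ((j : ℤ) - k - 1) ((k : ℤ) - i)) •
        basisVec K n (i + j + r - (2 * k + 1))
    else 0

/-- `A` is lower triangular and, as the matrix of a structure map (the `i`-th column is the
image of `x_i`), makes `K^(n+1)` with bracket `μ` a multiplicative filiform Hom-Lie algebra. -/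
def IsMultStructureMatrix {n : ℕ}
    (μ : (Fin (n + 1) → K) →ₗ[K] (Fin (n + 1) → K) →ₗ[K] (Fin (n + 1) → K))
    (A : Matrix (Fin (n + 1)) (Fin (n + 1)) K) : Prop :=
  (∀ i j, i < j → A i j = 0) ∧ IsMultFiliformHomLie μ (Matrix.toLin' A)

end Brackets

end HomLie

/-! Each bracket in the statement is adapted to the basis: it is alternating, it sends a pair `x_i,
x_j` with `i < j` into the span of the `x_l` with `l > j`, and `[x_0, x_m] = x_{m+1}` for `m ≥ 1`.
This forces `C^{k+1}` to be the span of the `x_l` with `l ≥ k + 2`, so nilpotency and the dimensions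
are automatic, and a multiplicative `α` preserves the central series. Hence only multiplicativity
and the Hom-Jacobi identity on basis vectors remain (`IsAdapted.isMultStructureMatrix_iff`). For
lower triangular `A` they form an explicit polynomial system in the entries
(`isMultStructureMatrix_three_iff` to `isMultStructureMatrix_six_iff`).

The relations `α x_{j+1} = [α x_0, α x_j]` determine every column of `A` from columns 0 and 1, and
make the diagonal entries successive multiples of `A 0 0` (with a correction in the last one when `d
≠ 0`). The other brackets then overdetermine some entries. Comparing the two values on the diagonal
gives factored equations such as `A 0 0 * A 1 1 * (A 1 1 - A 0 0 ^ 2) = 0`, whose factors separate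
the families.

Hom-Jacobi is vacuous up to dimension 5. In dimension 6 it gives two equations, from the triples
`(x_0, x_1, x_2)` and `(x_0, x_1, x_3)`. For `μ₀ + ψ_{1,4}` they pin `A 0 0` to `0` or `1/c`. For
`μ₀ + ψ_{1,4} + ψ_{2,5}` they lead, in some families, to `t ^ 2 + t - 1 = 0`, which is where the
square root of 5 enters. Conversely, each family is substituted into the system. -/

namespace HomLie

section General

variable {K : Type*} [Field K] {n : ℕ}

/-! ### Reduction of the identities to basis vectors. -/

/-- A linear function on `K^n` vanishing on the standard basis is zero. -/
theorem eq_zero_of_isLinearMap {W : Type*} [AddCommGroup W] [Module K W]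
    {F : (Fin n → K) → W} (hF : IsLinearMap K F)
    (h : ∀ i, F (Pi.single i 1) = 0) (x : Fin n → K) : F x = 0 := by
  have : hF.mk' F = 0 := (Pi.basisFun K (Fin n)).ext fun i => by simpa using h i
  simpa using LinearMap.congr_fun this x

theorem isMultiplicative_iff_basis
    {μ : (Fin n → K) →ₗ[K] (Fin n → K) →ₗ[K] (Fin n → K)} {α : (Fin n → K) →ₗ[K] (Fin n → K)}
    (hskew : ∀ x y, μ x y = -μ y x) (halt : ∀ x, μ x x = 0) :
    IsMultiplicative μ α ↔ ∀ i j : Fin n, i < j →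
      α (μ (Pi.single i 1) (Pi.single j 1)) = μ (α (Pi.single i 1)) (α (Pi.single j 1)) := by
  refine ⟨fun h i j _ => h _ _, fun h => ?_⟩
  have key : ∀ i j : Fin n,
      α (μ (Pi.single i 1) (Pi.single j 1)) - μ (α (Pi.single i 1)) (α (Pi.single j 1)) = 0 := by
    intro i j
    rcases lt_trichotomy i j with hij | rfl | hij
    · rw [h i j hij, sub_self]
    · rw [halt, halt, map_zero, sub_zero]
    · rw [hskew, map_neg, h j i hij, hskew (α (Pi.single i 1)), sub_self]
  intro x y
  rw [← sub_eq_zero]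
  refine eq_zero_of_isLinearMap (F := fun x => α (μ x y) - μ (α x) (α y)) ⟨?_, ?_⟩ (fun i => ?_) x
  · intro x x'; simp only [map_add, LinearMap.add_apply]; abel
  · intro c x; simp only [map_smul, LinearMap.smul_apply, smul_sub]
  · refine eq_zero_of_isLinearMap
      (F := fun y => α (μ (Pi.single i 1) y) - μ (α (Pi.single i 1)) (α y)) ⟨?_, ?_⟩
      (fun j => key i j) y
    · intro x x'; simp only [map_add]; abel
    · intro c x; simp only [map_smul, smul_sub]

/-- The cyclic sum is trilinear and alternating, so strictly increasing triples of basis vectors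
suffice. Being cyclic, it needs to be checked for linearity in the first argument only; rotation
handles the other two. -/
theorem hom_jacobi_iff_basis
    {μ : (Fin n → K) →ₗ[K] (Fin n → K) →ₗ[K] (Fin n → K)} {α : (Fin n → K) →ₗ[K] (Fin n → K)}
    (hskew : ∀ x y, μ x y = -μ y x) (halt : ∀ x, μ x x = 0) :
    (∀ x y z, μ (α x) (μ y z) + μ (α y) (μ z x) + μ (α z) (μ x y) = 0) ↔
      ∀ i j k : Fin n, i < j → j < k →
        μ (α (Pi.single i 1)) (μ (Pi.single j 1) (Pi.single k 1))
          + μ (α (Pi.single j 1)) (μ (Pi.single k 1) (Pi.single i 1))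
          + μ (α (Pi.single k 1)) (μ (Pi.single i 1) (Pi.single j 1)) = 0 := by
  refine ⟨fun h i j k _ _ => h _ _ _, fun h => ?_⟩
  set J : (Fin n → K) → (Fin n → K) → (Fin n → K) → (Fin n → K) := fun x y z =>
    μ (α x) (μ y z) + μ (α y) (μ z x) + μ (α z) (μ x y) with hJ
  have cyc : ∀ x y z, J x y z = J y z x := fun x y z => by simp only [hJ]; abel
  have swap : ∀ x y z, J x y z = -J y x z := fun x y z => by
    simp only [hJ, hskew y x, hskew x z, hskew z y, map_neg]; abel
  have diag : ∀ x z, J x x z = 0 := fun x z => by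
    simp only [hJ, hskew z x, halt, map_neg, map_zero]; abel
  have key : ∀ i j k : Fin n, J (Pi.single i 1) (Pi.single j 1) (Pi.single k 1) = 0 := by
    have lt : ∀ i j k : Fin n, i < j → J (Pi.single i 1) (Pi.single j 1) (Pi.single k 1) = 0 := by
      intro i j k hij
      rcases lt_trichotomy j k with hjk | rfl | hjk
      · exact h i j k hij hjk
      · rw [cyc, diag]
      · rcases lt_trichotomy i k with hik | rfl | hik
        · rw [cyc, cyc, swap, neg_eq_zero]; exact h i k j hik hjk
        · rw [cyc, cyc, diag]
        · rw [cyc, cyc]; exact h k i j hik hij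
    intro i j k
    rcases lt_trichotomy i j with hij | rfl | hij
    · exact lt i j k hij
    · exact diag _ _
    · rw [swap, lt j i k hij, neg_zero]
  have lin : ∀ y z, IsLinearMap K fun x => J x y z := fun y z =>
    ⟨fun x x' => by simp only [hJ, map_add, LinearMap.add_apply]; abel,
      fun c x => by simp only [hJ, map_smul, LinearMap.smul_apply, smul_add]⟩
  intro x y z
  refine eq_zero_of_isLinearMap (lin y z) (fun i => ?_) x
  rw [cyc]
  refine eq_zero_of_isLinearMap (lin z _) (fun j => ?_) y
  rw [cyc]
  refine eq_zero_of_isLinearMap (lin _ _) (fun k => ?_) z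
  rw [cyc]
  exact key i j k

/-! ### The filtration by tails of the basis. -/

/-- The vectors whose coordinates of index less than `k` vanish. -/
def tailSubmodule (K : Type*) [Field K] (n k : ℕ) : Submodule K (Fin (n + 1) → K) where
  carrier := {v | ∀ l : Fin (n + 1), (l : ℕ) < k → v l = 0}
  add_mem' ha hb l hl := by simp [ha l hl, hb l hl]
  zero_mem' l _ := rfl
  smul_mem' c v hv l hl := by simp [hv l hl]

theorem basisVec_mem_tailSubmodule {k m : ℕ} (h : k ≤ m) :
    basisVec K n m ∈ tailSubmodule K n k := fun l hl => by
  simp only [basisVec]; exact if_neg (by omega)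

theorem single_eq_basisVec (i : Fin (n + 1)) :
    (Pi.single i 1 : Fin (n + 1) → K) = basisVec K n i := by
  ext l; simp [basisVec, Pi.single_apply, Fin.ext_iff]

theorem finrank_tailSubmodule (k : ℕ) :
    Module.finrank K (tailSubmodule K n k) = n + 1 - k := by
  have e : tailSubmodule K n k ≃ₗ[K] ({l : Fin (n + 1) // k ≤ (l : ℕ)} → K) :=
    { toFun := fun v l => v.1 l
      map_add' := fun _ _ => rfl
      map_smul' := fun _ _ => rfl
      invFun := fun w => ⟨fun l => if h : k ≤ (l : ℕ) then w ⟨l, h⟩ else 0,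
        fun l hl => dif_neg (by omega)⟩
      left_inv := fun v => by
        ext l
        by_cases h : k ≤ (l : ℕ)
        · simp [h]
        · simp [h, v.2 l (by omega)]
      right_inv := fun w => by ext l; simp [l.2] }
  rw [e.finrank_eq, Module.finrank_fintype_fun_eq_card, Fintype.card_subtype]
  have := Fin.card_filter_val_lt (n := n + 1) (m := k)
  have h2 := Finset.card_filter_add_card_filter_not (s := Finset.univ)
    (p := fun l : Fin (n + 1) => (l : ℕ) < k)
  simp only [not_lt, Finset.card_univ, Fintype.card_fin] at h2
  omega

theorem tailSubmodule_eq_bot {k : ℕ} (h : n + 1 ≤ k) : tailSubmodule K n k = ⊥ := by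
  rw [eq_bot_iff]
  intro v hv
  ext l
  exact hv l (by omega)

/-- A submodule containing the last basis vectors contains the corresponding tail. -/
theorem tailSubmodule_le {k : ℕ} {S : Submodule K (Fin (n + 1) → K)}
    (h : ∀ m, k ≤ m → m ≤ n → basisVec K n m ∈ S) : tailSubmodule K n k ≤ S := by
  intro v hv
  rw [pi_eq_sum_univ' v]
  refine Submodule.sum_mem _ fun l _ => ?_
  by_cases hl : k ≤ (l : ℕ)
  · refine Submodule.smul_mem _ _ ?_
    convert h l hl (by omega) using 1
    rw [← single_eq_basisVec]
  · rw [hv l (by omega), zero_smul]; exact S.zero_mem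

/-! ### Skew brackets and the filtration. -/

theorem skewBracket_apply (f : ℕ → ℕ → Fin (n + 1) → K) (x y : Fin (n + 1) → K) :
    skewBracket f x y = ∑ i : Fin (n + 1), ∑ j : Fin (n + 1),
      if i < j then (x i * y j - x j * y i) • f i j else 0 := rfl

theorem skewBracket_skew (f : ℕ → ℕ → Fin (n + 1) → K) (x y : Fin (n + 1) → K) :
    skewBracket f x y = -skewBracket f y x := by
  simp only [skewBracket_apply, ← Finset.sum_neg_distrib]
  refine Finset.sum_congr rfl fun i _ => Finset.sum_congr rfl fun j _ => ?_
  split_ifs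
  · rw [← neg_smul]; congr 1; ring
  · simp

theorem skewBracket_self (f : ℕ → ℕ → Fin (n + 1) → K) (x : Fin (n + 1) → K) :
    skewBracket f x x = 0 := by
  rw [skewBracket_apply]
  refine Finset.sum_eq_zero fun i _ => Finset.sum_eq_zero fun j _ => ?_
  rw [mul_comm, sub_self, zero_smul, ite_self]

theorem skewBracket_mem_tailSubmodule_two {f : ℕ → ℕ → Fin (n + 1) → K}
    (hf : ∀ i j, i < j → f i j ∈ tailSubmodule K n (j + 1)) (x y : Fin (n + 1) → K) :
    skewBracket f x y ∈ tailSubmodule K n 2 := by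
  rw [skewBracket_apply]
  refine Submodule.sum_mem _ fun i _ => Submodule.sum_mem _ fun j _ => ?_
  split_ifs with h
  · exact Submodule.smul_mem _ _ fun l hl => hf i j h l (by have := Fin.lt_def.1 h; omega)
  · exact Submodule.zero_mem _

theorem skewBracket_mem_tailSubmodule_succ {f : ℕ → ℕ → Fin (n + 1) → K}
    (hf : ∀ i j, i < j → f i j ∈ tailSubmodule K n (j + 1)) (k : ℕ) (x : Fin (n + 1) → K)
    {y : Fin (n + 1) → K} (hy : y ∈ tailSubmodule K n k) :
    skewBracket f x y ∈ tailSubmodule K n (k + 1) := by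
  rw [skewBracket_apply]
  refine Submodule.sum_mem _ fun i _ => Submodule.sum_mem _ fun j _ => ?_
  split_ifs with h
  -- If `j < k`, then `i < k` too and both coordinates of `y` in the coefficient vanish; otherwise
  -- `f i j` already lies deep enough.
  · by_cases hj : (j : ℕ) < k
    · rw [hy j hj, hy i (lt_trans h hj), mul_zero, mul_zero, sub_self, zero_smul]
      exact Submodule.zero_mem _
    · exact Submodule.smul_mem _ _ fun l hl => hf i j h l (by omega)
  · exact Submodule.zero_mem _

/-! ### Adapted brackets and their central series. -/

/-- A bracket adapted to the basis `x_0, …, x_n`: alternating, raising the filtration by tails,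
and with `[x_0, x_m] = x_{m+1}` for `1 ≤ m`. -/
structure IsAdapted (μ : (Fin (n + 1) → K) →ₗ[K] (Fin (n + 1) → K) →ₗ[K] (Fin (n + 1) → K)) :
    Prop where
  skew : ∀ x y, μ x y = -μ y x
  self : ∀ x, μ x x = 0
  mem_tail_two : ∀ x y, μ x y ∈ tailSubmodule K n 2
  mem_tail_succ : ∀ k x, ∀ y ∈ tailSubmodule K n k, μ x y ∈ tailSubmodule K n (k + 1)
  apply_zero : ∀ m, 1 ≤ m → μ (basisVec K n 0) (basisVec K n m) = basisVec K n (m + 1)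

/-- A perturbation that does not involve `x_0` leaves `[x_0, x_m]` unchanged, so adaptedness
survives as long as the filtration is still raised. -/
theorem IsAdapted.add_skewBracket
    {μ : (Fin (n + 1) → K) →ₗ[K] (Fin (n + 1) → K) →ₗ[K] (Fin (n + 1) → K)} (hμ : IsAdapted μ)
    {f : ℕ → ℕ → Fin (n + 1) → K} (hf0 : ∀ j, f 0 j = 0)
    (hf : ∀ i j, i < j → f i j ∈ tailSubmodule K n (j + 1)) :
    IsAdapted (μ + skewBracket f) where
  skew x y := by
    rw [LinearMap.add_apply, LinearMap.add_apply, LinearMap.add_apply, LinearMap.add_apply,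
      hμ.skew, skewBracket_skew]; abel
  self x := by
    rw [LinearMap.add_apply, LinearMap.add_apply, hμ.self, skewBracket_self, add_zero]
  mem_tail_two x y :=
    Submodule.add_mem _ (hμ.mem_tail_two x y) (skewBracket_mem_tailSubmodule_two hf x y)
  mem_tail_succ k x y hy :=
    Submodule.add_mem _ (hμ.mem_tail_succ k x y hy)
      (skewBracket_mem_tailSubmodule_succ hf k x hy)
  apply_zero m hm := by
    rw [LinearMap.add_apply, LinearMap.add_apply, hμ.apply_zero m hm, skewBracket_apply,
      add_eq_left]
    refine Finset.sum_eq_zero fun i _ => Finset.sum_eq_zero fun j _ => ?_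
    split_ifs with h
    · have hj : (j : ℕ) ≠ 0 := by have := Fin.lt_def.1 h; omega
      by_cases hi : (i : ℕ) = 0
      · rw [hi, hf0, smul_zero]
      · simp [basisVec, hi, hj]
    · rfl

theorem isAdapted_mu0 : IsAdapted (mu0 K n) := by
  have hf : ∀ i j, i < j → (if i = 0 ∧ 1 ≤ j ∧ j + 1 ≤ n then basisVec K n (j + 1) else 0) ∈
      tailSubmodule K n (j + 1) := fun i j _ => by
    split_ifs
    · exact basisVec_mem_tailSubmodule le_rfl
    · exact Submodule.zero_mem _
  refine ⟨skewBracket_skew _, skewBracket_self _,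
    skewBracket_mem_tailSubmodule_two hf,
    fun k x y hy => skewBracket_mem_tailSubmodule_succ hf k x hy, fun m hm => ?_⟩
  · rw [mu0, skewBracket_apply]
    by_cases hmn : m ≤ n
    · rw [Finset.sum_eq_single 0, Finset.sum_eq_single ⟨m, by omega⟩]
      · have h0 : m ≠ 0 := by omega
        -- For `m = n` the bracket is zero by definition, and `basisVec K n (n + 1)` is zero by
        -- convention.
        by_cases h1 : m + 1 ≤ n
        · simp [basisVec, h0, Fin.lt_def, hm, h1, Nat.pos_of_ne_zero h0]
        · simp [basisVec, h0, Fin.lt_def, h1]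
          ext l
          exact (if_neg (by omega)).symm
      · intro j _ hj
        have hj' : (j : ℕ) ≠ m := fun h => hj (Fin.ext h)
        split_ifs <;> simp_all [basisVec]
        omega
      · simp
      · intro i _ hi
        refine Finset.sum_eq_zero fun j _ => ?_
        have : (i : ℕ) ≠ 0 := fun h => hi (Fin.ext h)
        simp [this]
      · simp
    · have h1 : basisVec K n m = 0 := by ext l; exact if_neg (by omega)
      have h2 : basisVec K n (m + 1) = 0 := by ext l; exact if_neg (by omega)
      simp [h1, h2]

/-- Under `2 * k + 1 ≤ r` the truncated subtraction in the index of `psi` is a true one, and the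
index is at least `i + j ≥ j + 1`. -/
theorem IsAdapted.add_psi
    {μ : (Fin (n + 1) → K) →ₗ[K] (Fin (n + 1) → K) →ₗ[K] (Fin (n + 1) → K)} (hμ : IsAdapted μ)
    (C : ℤ → ℤ → K) {k r : ℕ} (hr : 2 * k + 1 ≤ r) : IsAdapted (μ + psi C n k r) := by
  refine hμ.add_skewBracket (fun j => if_neg (by omega)) fun i j _ => ?_
  split_ifs
  · exact Submodule.smul_mem _ _ (basisVec_mem_tailSubmodule (by omega))
  · exact Submodule.zero_mem _

/-- The first step from `⊤` drops both `x_0` and `x_1`, and each later step drops one vector; hence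
the shift `k + 1` against `k + 2`. The reverse inclusion holds because `x_{m+1} = [x_0, x_m]`. -/
theorem IsAdapted.centralSeries_succ
    {μ : (Fin (n + 1) → K) →ₗ[K] (Fin (n + 1) → K) →ₗ[K] (Fin (n + 1) → K)} (hμ : IsAdapted μ)
    (k : ℕ) : centralSeries μ (k + 1) = tailSubmodule K n (k + 2) := by
  induction k with
  | zero =>
    refine le_antisymm (Submodule.map₂_le.2 fun x _ y _ => hμ.mem_tail_two x y)
      (tailSubmodule_le fun m h1 _ => ?_)
    obtain ⟨m, rfl⟩ : ∃ l, m = l + 1 := ⟨m - 1, by omega⟩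
    rw [← hμ.apply_zero m (by omega)]
    exact Submodule.apply_mem_map₂ _ trivial trivial
  | succ k ih =>
    rw [centralSeries, ih]
    refine le_antisymm (Submodule.map₂_le.2 fun x _ y hy => hμ.mem_tail_succ _ x y hy)
      (tailSubmodule_le fun m h1 _ => ?_)
    obtain ⟨m, rfl⟩ : ∃ l, m = l + 1 := ⟨m - 1, by omega⟩
    rw [← hμ.apply_zero m (by omega)]
    exact Submodule.apply_mem_map₂ _ trivial (basisVec_mem_tailSubmodule (by omega))

theorem map_centralSeries_le {V : Type*} [AddCommGroup V] [Module K V] {μ : V →ₗ[K] V →ₗ[K] V}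
    {α : V →ₗ[K] V} (h : IsMultiplicative μ α) (m : ℕ) :
    (centralSeries μ m).map α ≤ centralSeries μ m := by
  induction m with
  | zero => exact le_top
  | succ m ih =>
    rw [Submodule.map_le_iff_le_comap, centralSeries, Submodule.map₂_le]
    intro x _ y hy
    rw [Submodule.mem_comap, h]
    exact Submodule.apply_mem_map₂ _ trivial (ih (Submodule.mem_map_of_mem hy))

/-- The structure maps of an adapted bracket: all conditions but multiplicativity and the
Hom-Jacobi identity on basis vectors are automatic. -/
theorem IsAdapted.isMultStructureMatrix_iff
    {μ : (Fin (n + 1) → K) →ₗ[K] (Fin (n + 1) → K) →ₗ[K] (Fin (n + 1) → K)} (hμ : IsAdapted μ)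
    (hn : 2 ≤ n) (A : Matrix (Fin (n + 1)) (Fin (n + 1)) K) :
    IsMultStructureMatrix μ A ↔ (∀ i j, i < j → A i j = 0) ∧
      (∀ i j, i < j → A.mulVec (μ (Pi.single i 1) (Pi.single j 1)) = μ (A.col i) (A.col j)) ∧
      ∀ i j k, i < j → j < k → μ (A.col i) (μ (Pi.single j 1) (Pi.single k 1))
        + μ (A.col j) (μ (Pi.single k 1) (Pi.single i 1))
        + μ (A.col k) (μ (Pi.single i 1) (Pi.single j 1)) = 0 := by
  have hm := isMultiplicative_iff_basis (α := Matrix.toLin' A) hμ.skew hμ.self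
  have hj := hom_jacobi_iff_basis (α := Matrix.toLin' A) hμ.skew hμ.self
  simp only [Matrix.toLin'_apply, Matrix.mulVec_single_one] at hm hj
  refine and_congr_right fun _ => ?_
  constructor
  · rintro ⟨h1, h2, h3⟩
    exact ⟨hm.1 h3, hj.1 fun x y z => h1.hom_jacobi x y z⟩
  · rintro ⟨h1, h2⟩
    have h3 := hm.2 h1
    refine ⟨⟨hμ.skew, hj.2 h2⟩, ⟨map_centralSeries_le h3, ?_, ?_⟩, h3⟩
    · obtain ⟨n, rfl⟩ : ∃ l, n = l + 2 := ⟨n - 2, by omega⟩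
      -- With `n + 2` as the last index, `C^{n+1}` is the line spanned by the last basis vector, and
      -- the next term is zero.
      refine ⟨n + 1, ?_, fun h => ?_⟩
      · rw [hμ.centralSeries_succ, tailSubmodule_eq_bot (by omega)]
      · rw [hμ.centralSeries_succ] at h
        have := finrank_tailSubmodule (K := K) (n := n + 2) (n + 2)
        rw [h, finrank_bot] at this
        omega
    · intro k h1 h2
      obtain ⟨k, rfl⟩ : ∃ l, k = l + 1 := ⟨k - 1, by omega⟩
      rw [hμ.centralSeries_succ, finrank_tailSubmodule]
      rw [Module.finrank_fin_fun] at h2 ⊢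
      omega

end General

end HomLie

namespace HomLie

section LowDimension

variable {K : Type*} [Field K]

/-! ### Matrix equations read entry by entry. -/

theorem eq_lowerTriangular_three {A : Matrix (Fin 3) (Fin 3) K}
    {b00 b10 b11 b20 b21 b22 : K} :
    A = !![b00, 0, 0; b10, b11, 0; b20, b21, b22] ↔
      (∀ i j, i < j → A i j = 0) ∧
        A 0 0 = b00 ∧ A 1 0 = b10 ∧ A 1 1 = b11 ∧ A 2 0 = b20 ∧ A 2 1 = b21 ∧ A 2 2 = b22 := by
  constructor
  · rintro rfl
    refine ⟨fun i j h => ?_, by simp⟩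
    fin_cases i <;> fin_cases j <;> first | rfl | simp at h
  · rintro ⟨h, rfl, rfl, rfl, rfl, rfl, rfl⟩
    ext i j
    fin_cases i <;> fin_cases j <;> first | rfl | exact h _ _ (by decide)

theorem eq_lowerTriangular_four {A : Matrix (Fin 4) (Fin 4) K}
    {b00 b10 b11 b20 b21 b22 b30 b31 b32 b33 : K} :
    A = !![b00, 0, 0, 0; b10, b11, 0, 0; b20, b21, b22, 0; b30, b31, b32, b33] ↔
      (∀ i j, i < j → A i j = 0) ∧
        A 0 0 = b00 ∧ A 1 0 = b10 ∧ A 1 1 = b11 ∧ A 2 0 = b20 ∧ A 2 1 = b21 ∧ A 2 2 = b22 ∧ A 3 0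
        = b30 ∧ A 3 1 = b31 ∧ A 3 2 = b32 ∧ A 3 3 = b33 := by
  constructor
  · rintro rfl
    refine ⟨fun i j h => ?_, by simp⟩
    fin_cases i <;> fin_cases j <;> first | rfl | simp at h
  · rintro ⟨h, rfl, rfl, rfl, rfl, rfl, rfl, rfl, rfl, rfl, rfl⟩
    ext i j
    fin_cases i <;> fin_cases j <;> first | rfl | exact h _ _ (by decide)

theorem eq_lowerTriangular_five {A : Matrix (Fin 5) (Fin 5) K}
    {b00 b10 b11 b20 b21 b22 b30 b31 b32 b33 b40 b41 b42 b43 b44 : K} :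
    A = !![b00, 0, 0, 0, 0; b10, b11, 0, 0, 0; b20, b21, b22, 0, 0; b30, b31, b32, b33, 0; b40, b41,
      b42, b43, b44] ↔
      (∀ i j, i < j → A i j = 0) ∧
        A 0 0 = b00 ∧ A 1 0 = b10 ∧ A 1 1 = b11 ∧ A 2 0 = b20 ∧ A 2 1 = b21 ∧ A 2 2 = b22 ∧ A 3 0
        = b30 ∧ A 3 1 = b31 ∧ A 3 2 = b32 ∧ A 3 3 = b33 ∧ A 4 0 = b40 ∧ A 4 1 = b41 ∧ A 4 2 = b42
        ∧ A 4 3 = b43 ∧ A 4 4 = b44 := by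
  constructor
  · rintro rfl
    refine ⟨fun i j h => ?_, by simp⟩
    fin_cases i <;> fin_cases j <;> first | rfl | simp at h
  · rintro ⟨h, rfl, rfl, rfl, rfl, rfl, rfl, rfl, rfl, rfl, rfl, rfl, rfl, rfl, rfl, rfl⟩
    ext i j
    fin_cases i <;> fin_cases j <;> first | rfl | exact h _ _ (by decide)

theorem eq_lowerTriangular_six {A : Matrix (Fin 6) (Fin 6) K}
    {b00 b10 b11 b20 b21 b22 b30 b31 b32 b33 b40 b41 b42 b43 b44 b50 b51 b52 b53 b54 b55 : K} :
    A = !![b00, 0, 0, 0, 0, 0; b10, b11, 0, 0, 0, 0; b20, b21, b22, 0, 0, 0; b30, b31, b32, b33, 0, 0;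
      b40, b41, b42, b43, b44, 0; b50, b51, b52, b53, b54, b55] ↔
      (∀ i j, i < j → A i j = 0) ∧
        A 0 0 = b00 ∧ A 1 0 = b10 ∧ A 1 1 = b11 ∧ A 2 0 = b20 ∧ A 2 1 = b21 ∧ A 2 2 = b22 ∧ A 3 0
        = b30 ∧ A 3 1 = b31 ∧ A 3 2 = b32 ∧ A 3 3 = b33 ∧ A 4 0 = b40 ∧ A 4 1 = b41 ∧ A 4 2 = b42
        ∧ A 4 3 = b43 ∧ A 4 4 = b44 ∧ A 5 0 = b50 ∧ A 5 1 = b51 ∧ A 5 2 = b52 ∧ A 5 3 = b53 ∧ A 5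
        4 = b54 ∧ A 5 5 = b55 := by
  constructor
  · rintro rfl
    refine ⟨fun i j h => ?_, by simp⟩
    fin_cases i <;> fin_cases j <;> first | rfl | simp at h
  · rintro ⟨h, rfl, rfl, rfl, rfl, rfl, rfl, rfl, rfl, rfl, rfl, rfl, rfl, rfl, rfl, rfl, rfl, rfl, rfl,
      rfl, rfl, rfl⟩
    ext i j
    fin_cases i <;> fin_cases j <;> first | rfl | exact h _ _ (by decide)

/-! ### The polynomial systems in dimensions 3 to 6. -/

theorem isMultStructureMatrix_three_iff
    {μ : (Fin 3 → K) →ₗ[K] (Fin 3 → K) →ₗ[K] (Fin 3 → K)} (hμ : IsAdapted μ)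
    (h : ∀ x y, μ x y = ![0, 0, x 0 * y 1 - x 1 * y 0])
    (A : Matrix (Fin 3) (Fin 3) K) :
    IsMultStructureMatrix μ A ↔ (∀ i j, i < j → A i j = 0) ∧
      A 2 2 = A 0 0 * A 1 1 := by
  rw [hμ.isMultStructureMatrix_iff (by decide)]
  refine and_congr_right fun ht => ?_
  simp [h, funext_iff, Matrix.mulVec, dotProduct, Fin.forall_fin_succ, Fin.sum_univ_succ,
    ht 0 1, ht 0 2, ht 1 2]

theorem isMultStructureMatrix_four_iff
    {μ : (Fin 4 → K) →ₗ[K] (Fin 4 → K) →ₗ[K] (Fin 4 → K)} (hμ : IsAdapted μ)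
    (h : ∀ x y, μ x y = ![0, 0, x 0 * y 1 - x 1 * y 0, x 0 * y 2 - x 2 * y 0])
    (A : Matrix (Fin 4) (Fin 4) K) :
    IsMultStructureMatrix μ A ↔ (∀ i j, i < j → A i j = 0) ∧
      A 2 2 = A 0 0 * A 1 1 ∧
      A 3 2 = A 0 0 * A 2 1 ∧
      A 3 3 = A 0 0 * A 2 2 := by
  rw [hμ.isMultStructureMatrix_iff (by decide)]
  refine and_congr_right fun ht => ?_
  simp [h, funext_iff, Matrix.mulVec, dotProduct, Fin.forall_fin_succ, Fin.sum_univ_succ,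
    ht 0 1, ht 0 2, ht 0 3, ht 1 2, ht 1 3, ht 2 3, and_assoc]

/-- All equations but the last come from the pairs `(x_0, x_j)`; the last is the pair `(x_1, x_2)`.
No Hom-Jacobi equation survives: the brackets involved vanish in this dimension. -/
theorem isMultStructureMatrix_five_iff {p : K}
    {μ : (Fin 5 → K) →ₗ[K] (Fin 5 → K) →ₗ[K] (Fin 5 → K)} (hμ : IsAdapted μ)
    (h : ∀ x y, μ x y = ![0, 0, x 0 * y 1 - x 1 * y 0, x 0 * y 2 - x 2 * y 0,
      x 0 * y 3 - x 3 * y 0 + p * (x 1 * y 2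
      - x 2 * y 1)])
    (A : Matrix (Fin 5) (Fin 5) K) :
    IsMultStructureMatrix μ A ↔ (∀ i j, i < j → A i j = 0) ∧
      A 2 2 = A 0 0 * A 1 1 ∧
      A 3 2 = A 0 0 * A 2 1 ∧
      A 4 2 = A 0 0 * A 3 1 + p * (A 1 0 * A 2 1 - A 2 0 * A 1 1) ∧
      A 3 3 = A 0 0 * A 2 2 ∧
      A 4 3 = A 0 0 * A 3 2 + p * (A 1 0 * A 2 2) ∧
      A 4 4 = A 0 0 * A 3 3 ∧
      A 4 4 * p = p * (A 1 1 * A 2 2) := by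
  rw [hμ.isMultStructureMatrix_iff (by decide)]
  refine and_congr_right fun ht => ?_
  simp [h, funext_iff, Matrix.mulVec, dotProduct, Fin.forall_fin_succ, Fin.sum_univ_succ,
    ht 0 1, ht 0 2, ht 0 3, ht 0 4, ht 1 2, ht 1 3, ht 1 4, ht 2 3, ht 2 4, ht 3 4, and_assoc]

/-- The coefficients `p, q, c, d, e` cover all brackets of dimension 6 at once. The ten equations
with left side `A i j` come from the pairs `(x_0, x_j)`; the next five from `(x_1, x_2)`
(coordinates 4 and 5), `(x_1, x_3)`, `(x_1, x_4)` and `(x_2, x_3)`. The last two are Hom-Jacobi on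
`(x_0, x_1, x_2)` and `(x_0, x_1, x_3)`. -/
theorem isMultStructureMatrix_six_iff {p q c d e : K}
    {μ : (Fin 6 → K) →ₗ[K] (Fin 6 → K) →ₗ[K] (Fin 6 → K)} (hμ : IsAdapted μ)
    (h : ∀ x y, μ x y = ![0, 0, x 0 * y 1 - x 1 * y 0, x 0 * y 2 - x 2 * y 0,
      x 0 * y 3 - x 3 * y 0 + p * (x 1 * y 2
      - x 2 * y 1), x 0 * y 4 - x 4 * y 0 + q * (x 1 * y 2 - x 2 * y 1) + c * (x 1 * y 3 - x 3 * y
      1) - d * (x 1 * y 4 - x 4 * y 1) + e * (x 2 * y 3 - x 3 * y 2)])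
    (A : Matrix (Fin 6) (Fin 6) K) :
    IsMultStructureMatrix μ A ↔ (∀ i j, i < j → A i j = 0) ∧
      A 2 2 = A 0 0 * A 1 1 ∧
      A 3 2 = A 0 0 * A 2 1 ∧
      A 4 2 = A 0 0 * A 3 1 + p * (A 1 0 * A 2 1 - A 2 0 * A 1 1) ∧
      A 5 2 = A 0 0 * A 4 1 + q * (A 1 0 * A 2 1 - A 2 0 * A 1 1) + c * (A 1 0 * A 3 1 - A 3 0 *
        A 1 1) - d * (A 1 0 * A 4 1 - A 4 0 * A 1 1) + e * (A 2 0 * A 3 1 - A 3 0 * A 2 1) ∧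
      A 3 3 = A 0 0 * A 2 2 ∧
      A 4 3 = A 0 0 * A 3 2 + p * (A 1 0 * A 2 2) ∧
      A 5 3 = A 0 0 * A 4 2 + q * (A 1 0 * A 2 2) + c * (A 1 0 * A 3 2) - d * (A 1 0 * A 4 2) +
        e * (A 2 0 * A 3 2 - A 3 0 * A 2 2) ∧
      A 4 4 = A 0 0 * A 3 3 ∧
      A 5 4 = A 0 0 * A 4 3 + c * (A 1 0 * A 3 3) - d * (A 1 0 * A 4 3) + e * (A 2 0 * A 3 3) ∧
      A 5 5 = A 0 0 * A 4 4 - d * (A 1 0 * A 4 4) ∧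
      A 4 4 * p = p * (A 1 1 * A 2 2) ∧
      A 5 4 * p + A 5 5 * q = q * (A 1 1 * A 2 2) + c * (A 1 1 * A 3 2) - d * (A 1 1 * A 4 2) +
        e * (A 2 1 * A 3 2 - A 3 1 * A 2 2) ∧
      A 5 5 * c = c * (A 1 1 * A 3 3) - d * (A 1 1 * A 4 3) + e * (A 2 1 * A 3 3) ∧
      A 5 5 * d = d * (A 1 1 * A 4 4) ∧
      A 5 5 * e = e * (A 2 2 * A 3 3) ∧
      A 0 0 * p - d * (A 1 0 * p) + (-(c * A 1 1) + -(e * A 2 1)) + -(e * A 3 2) = 0 ∧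
      d * A 1 1 + -(e * A 3 3) = 0 := by
  rw [hμ.isMultStructureMatrix_iff (by decide)]
  refine and_congr_right fun ht => ?_
  simp [h, funext_iff, Matrix.mulVec, dotProduct, Fin.forall_fin_succ, Fin.sum_univ_succ,
    ht 0 1, ht 0 2, ht 0 3, ht 0 4, ht 0 5, ht 1 2, ht 1 3, ht 1 4, ht 1 5, ht 2 3, ht 2 4, ht 2
    5, ht 3 4, ht 3 5, ht 4 5, and_assoc]

/-! ### The brackets in coordinates. -/

theorem mu0_two (x y : Fin 3 → K) : mu0 K 2 x y = ![0, 0, x 0 * y 1 - x 1 * y 0] := by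
  rw [mu0, skewBracket_apply]
  ext l
  fin_cases l <;> simp [Fin.sum_univ_succ, basisVec]

theorem mu0_three (x y : Fin 4 → K) :
    mu0 K 3 x y = ![0, 0, x 0 * y 1 - x 1 * y 0, x 0 * y 2 - x 2 * y 0] := by
  rw [mu0, skewBracket_apply]
  ext l
  fin_cases l <;> simp [Fin.sum_univ_succ, basisVec]

theorem mu0_four (x y : Fin 5 → K) :
    mu0 K 4 x y = ![0, 0, x 0 * y 1 - x 1 * y 0, x 0 * y 2 - x 2 * y 0,
      x 0 * y 3 - x 3 * y 0] := by
  rw [mu0, skewBracket_apply]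
  ext l
  fin_cases l <;> simp [Fin.sum_univ_succ, basisVec]

theorem mu0_five (x y : Fin 6 → K) :
    mu0 K 5 x y = ![0, 0, x 0 * y 1 - x 1 * y 0, x 0 * y 2 - x 2 * y 0,
      x 0 * y 3 - x 3 * y 0, x 0 * y 4 - x 4 * y 0] := by
  rw [mu0, skewBracket_apply]
  ext l
  fin_cases l <;> simp [Fin.sum_univ_succ, basisVec]

theorem psi_four_one_four {C : ℤ → ℤ → K} (h00 : C 0 0 = 1) (x y : Fin 5 → K) :
    psi C 4 1 4 x y = ![0, 0, 0, 0, x 1 * y 2 - x 2 * y 1] := by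
  rw [psi, skewBracket_apply]
  ext l
  fin_cases l <;> simp [Fin.sum_univ_succ, basisVec, h00]

theorem psi_five_one_four {C : ℤ → ℤ → K} (h00 : C 0 0 = 1) (x y : Fin 6 → K) :
    psi C 5 1 4 x y =
      ![0, 0, 0, 0, x 1 * y 2 - x 2 * y 1, (x 1 * y 3 - x 3 * y 1) * C 1 0] := by
  rw [psi, skewBracket_apply]
  ext l
  fin_cases l <;> simp [Fin.sum_univ_succ, basisVec, h00]

theorem psi_five_one_five {C : ℤ → ℤ → K} (h00 : C 0 0 = 1) (x y : Fin 6 → K) :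
    psi C 5 1 5 x y = ![0, 0, 0, 0, 0, x 1 * y 2 - x 2 * y 1] := by
  rw [psi, skewBracket_apply]
  ext l
  fin_cases l <;> simp [Fin.sum_univ_succ, basisVec, h00]

theorem psi_five_two_five {C : ℤ → ℤ → K} (h00 : C 0 0 = 1)
    (hC : ∀ q p : ℤ, q < p → C q p = 0) (x y : Fin 6 → K) :
    psi C 5 2 5 x y =
      ![0, 0, 0, 0, 0, -((x 1 * y 4 - x 4 * y 1) * C 1 1) + (x 2 * y 3 - x 3 * y 2)] := by
  -- These coefficients belong to the pairs `(x_1, x_3)` and `(x_1, x_2)`, which would otherwise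
  -- contribute multiples of `x_4` and `x_3`.
  have h01 : C 0 1 = 0 := hC _ _ (by norm_num)
  have h02 : C (-1) 1 = 0 := hC _ _ (by norm_num)
  rw [psi, skewBracket_apply]
  ext l
  fin_cases l <;> simp [Fin.sum_univ_succ, basisVec, h00, h01, h02]

/-- The entries of a matrix with transposed natural-number indices, as in `ρ i j = A j i`. -/
def transposedEntries {n : ℕ} (A : Matrix (Fin (n + 1)) (Fin (n + 1)) K) : ℕ → ℕ → K :=
  fun i j => A (Fin.ofNat _ j) (Fin.ofNat _ i)

end LowDimension

end HomLie

namespace HomLie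

section Classification

variable {K : Type*} [Field K] {C : ℤ → ℤ → K}

/-! ### Solving the systems, one bracket at a time. -/

theorem isMultStructureMatrix_mu0_two
    (A : Matrix (Fin 3) (Fin 3) K) :
      IsMultStructureMatrix (mu0 K 2) A ↔
        (∃ ρ : ℕ → ℕ → K, A = !![ρ 0 0, 0, 0; ρ 0 1, ρ 1 1, 0; ρ 0 2, ρ 1 2, ρ 0 0 * ρ 1 1]) ∨
        (∃ ρ : ℕ → ℕ → K, A = !![0, 0, 0; ρ 0 1, ρ 1 1, 0; ρ 0 2, ρ 1 2, 0]) := by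
  rw [isMultStructureMatrix_three_iff isAdapted_mu0 mu0_two]
  constructor
  · rintro ⟨ht, e22⟩
    -- The parameters are always read off the matrix itself, `ρ i j = A j i`, so free entries match
    -- by `rfl`. The second family is the case `ρ 0 0 = 0` of the first.
    exact Or.inl ⟨transposedEntries A,
      eq_lowerTriangular_three.2 ⟨ht, rfl, rfl, rfl, rfl, rfl, e22⟩⟩
  · rintro (⟨ρ, h⟩ | ⟨ρ, h⟩) <;>
    · rw [eq_lowerTriangular_three] at h
      exact ⟨h.1, by simp [h]⟩

theorem isMultStructureMatrix_mu0_three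
    (A : Matrix (Fin 4) (Fin 4) K) :
      IsMultStructureMatrix (mu0 K 3) A ↔
        (∃ ρ : ℕ → ℕ → K, ρ 0 0 ≠ 0 ∧ A = !![ρ 0 0, 0, 0, 0; ρ 0 1, ρ 2 2 / ρ 0 0, 0, 0; ρ 0 2,
          ρ 1 2, ρ 2 2, 0; ρ 0 3, ρ 1 3, ρ 1 2 * ρ 0 0, ρ 0 0 * ρ 2 2]) ∨
        (∃ ρ : ℕ → ℕ → K, A = !![0, 0, 0, 0; ρ 0 1, ρ 1 1, 0, 0; ρ 0 2, ρ 1 2, 0, 0; ρ 0 3, ρ 1 3,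
          0, 0]) := by
  rw [isMultStructureMatrix_four_iff isAdapted_mu0 mu0_three]
  constructor
  · rintro ⟨ht, e22, e32, e33⟩
    -- For `μ₀`, `A 0 0 = 0` kills all columns from the third on. Otherwise one can divide by `A 0
    -- 0` and take later entries as parameters for column 1.
    by_cases h0 : A 0 0 = 0
    · rw [h0, zero_mul] at e22 e32 e33
      exact Or.inr ⟨transposedEntries A, eq_lowerTriangular_four.2
        ⟨ht, h0, rfl, rfl, rfl, rfl, e22, rfl, rfl, e32, e33⟩⟩
    · have e11 : A 1 1 = A 2 2 / A 0 0 := by rw [e22, mul_div_cancel_left₀ _ h0]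
      rw [mul_comm] at e32
      exact Or.inl ⟨transposedEntries A, h0, eq_lowerTriangular_four.2
        ⟨ht, rfl, rfl, e11, rfl, rfl, rfl, rfl, rfl, e32, e33⟩⟩
  · rintro (⟨ρ, h0, h⟩ | ⟨ρ, h⟩)
    · rw [eq_lowerTriangular_four] at h
      obtain ⟨ht, h⟩ := h
      refine ⟨ht, ?_⟩; and_intros <;> simp only [h] <;> field_simp
    · rw [eq_lowerTriangular_four] at h
      obtain ⟨ht, h⟩ := h
      refine ⟨ht, ?_⟩; and_intros <;> simp only [h] <;> ring

theorem isMultStructureMatrix_mu0_four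
    (A : Matrix (Fin 5) (Fin 5) K) :
      IsMultStructureMatrix (mu0 K 4) A ↔
        (∃ ρ : ℕ → ℕ → K, ρ 0 0 ≠ 0 ∧ A = !![ρ 0 0, 0, 0, 0, 0; ρ 0 1, ρ 2 2 / ρ 0 0, 0, 0, 0;
          ρ 0 2, ρ 2 3 / ρ 0 0, ρ 2 2, 0, 0; ρ 0 3, ρ 1 3, ρ 2 3, ρ 0 0 * ρ 2 2, 0; ρ 0 4, ρ 1 4,
          ρ 0 0 * ρ 1 3, ρ 0 0 * ρ 2 3, ρ 0 0 ^ 2 * ρ 2 2]) ∨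
        (∃ ρ : ℕ → ℕ → K, A = !![0, 0, 0, 0, 0; ρ 0 1, ρ 1 1, 0, 0, 0; ρ 0 2, ρ 1 2, 0, 0, 0;
          ρ 0 3, ρ 1 3, 0, 0, 0; ρ 0 4, ρ 1 4, 0, 0, 0]) := by
  rw [isMultStructureMatrix_five_iff (p := 0) isAdapted_mu0
    fun x y => by rw [mu0_four, zero_mul, add_zero]]
  constructor
  · rintro ⟨ht, e22, e32, e42, e33, e43, e44, -⟩
    simp only [zero_mul, add_zero] at e42 e43
    by_cases h0 : A 0 0 = 0
    · rw [h0, zero_mul] at e22 e32 e42 e33 e43 e44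
      exact Or.inr ⟨transposedEntries A, eq_lowerTriangular_five.2
        ⟨ht, h0, rfl, rfl, rfl, rfl, e22, rfl, rfl, e32, e33, rfl, rfl, e42, e43, e44⟩⟩
    · have e11 : A 1 1 = A 2 2 / A 0 0 := by rw [e22, mul_div_cancel_left₀ _ h0]
      have e21 : A 2 1 = A 3 2 / A 0 0 := by rw [e32, mul_div_cancel_left₀ _ h0]
      have e44' : A 4 4 = A 0 0 ^ 2 * A 2 2 := by rw [e44, e33]; ring
      exact Or.inl ⟨transposedEntries A, h0, eq_lowerTriangular_five.2
        ⟨ht, rfl, rfl, e11, rfl, e21, rfl, rfl, rfl, rfl, e33, rfl, rfl, e42, e43, e44'⟩⟩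
  · rintro (⟨ρ, h0, h⟩ | ⟨ρ, h⟩)
    · rw [eq_lowerTriangular_five] at h
      obtain ⟨ht, h⟩ := h
      refine ⟨ht, ?_⟩; and_intros <;> simp only [h] <;> field_simp <;> ring
    · rw [eq_lowerTriangular_five] at h
      obtain ⟨ht, h⟩ := h
      refine ⟨ht, ?_⟩; and_intros <;> simp only [h] <;> ring

theorem isMultStructureMatrix_mu0_four_add_psi_one_four (h00 : C 0 0 = 1)
    (A : Matrix (Fin 5) (Fin 5) K) :
      IsMultStructureMatrix (mu0 K 4 + psi C 4 1 4) A ↔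
        (∃ ρ : ℕ → ℕ → K, A = !![0, 0, 0, 0, 0; ρ 0 1, ρ 1 1, 0, 0, 0; ρ 0 2, ρ 1 2, 0, 0, 0;
          ρ 0 3, ρ 1 3, 0, 0, 0; ρ 0 4, ρ 1 4, -(ρ 1 1 * ρ 0 2) + ρ 1 2 * ρ 0 1, 0, 0]) ∨
        (∃ ρ : ℕ → ℕ → K, A = !![ρ 0 0, 0, 0, 0, 0; ρ 0 1, 0, 0, 0, 0; ρ 0 2, ρ 1 2, 0, 0, 0;
          ρ 0 3, ρ 1 3, ρ 0 0 * ρ 1 2, 0, 0; ρ 0 4, ρ 1 4, ρ 0 1 * ρ 1 2 + ρ 0 0 * ρ 1 3,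
          ρ 0 0 ^ 2 * ρ 1 2, 0]) ∨
        (∃ ρ : ℕ → ℕ → K, A = !![ρ 0 0, 0, 0, 0, 0; ρ 0 1, ρ 0 0 ^ 2, 0, 0, 0; ρ 0 2, ρ 1 2,
          ρ 0 0 ^ 3, 0, 0; ρ 0 3, ρ 1 3, ρ 0 0 * ρ 1 2, ρ 0 0 ^ 4, 0; ρ 0 4, ρ 1 4, ρ 0 1 * ρ 1 2
          + ρ 0 0 * ρ 1 3 - ρ 0 0 ^ 2 * ρ 0 2, ρ 0 0 ^ 2 * (ρ 0 0 * ρ 0 1 + ρ 1 2), ρ 0 0 ^ 5]) := by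
  rw [isMultStructureMatrix_five_iff (p := 1) (isAdapted_mu0.add_psi C (by decide)) fun x y => by
    rw [LinearMap.add_apply, LinearMap.add_apply, mu0_four, psi_four_one_four h00]; simp]
  constructor
  · rintro ⟨ht, e22, e32, e42, e33, e43, e44, e12⟩
    -- Since `x_4` is both `[x_0, x_3]` and `[x_1, x_2]`, the entry `A 4 4` equals both `A 0 0 ^ 3 *
    -- A 1 1` and `A 0 0 * A 1 1 ^ 2`. The three factors give the three families.
    have key : A 0 0 * A 1 1 * (A 1 1 - A 0 0 ^ 2) = 0 := by
      linear_combination -e12 + e44 + A 0 0 * e33 + (A 0 0 ^ 2 - A 1 1) * e22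
    rcases mul_eq_zero.1 key with key | h11
    · rcases mul_eq_zero.1 key with h0 | h11
      · rw [h0] at e22 e32 e42 e33 e43 e44
        rw [zero_mul] at e22 e32 e33 e44
        have e42' : A 4 2 = -(A 1 1 * A 2 0) + A 2 1 * A 1 0 := by linear_combination e42
        have e43' : A 4 3 = 0 := by linear_combination e43 + A 1 0 * e22
        exact Or.inl ⟨transposedEntries A, eq_lowerTriangular_five.2
          ⟨ht, h0, rfl, rfl, rfl, rfl, e22, rfl, rfl, e32, e33, rfl, rfl, e42', e43', e44⟩⟩
      · rw [h11, mul_zero] at e22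
        rw [e22, mul_zero] at e33
        rw [e33, mul_zero] at e44
        have e42' : A 4 2 = A 1 0 * A 2 1 + A 0 0 * A 3 1 := by
          linear_combination e42 - A 2 0 * h11
        have e43' : A 4 3 = A 0 0 ^ 2 * A 2 1 := by
          linear_combination e43 + A 0 0 * e32 + A 1 0 * e22
        exact Or.inr (Or.inl ⟨transposedEntries A, eq_lowerTriangular_five.2
          ⟨ht, rfl, rfl, h11, rfl, rfl, e22, rfl, rfl, e32, e33, rfl, rfl, e42', e43', e44⟩⟩)
    · rw [sub_eq_zero] at h11
      have e22' : A 2 2 = A 0 0 ^ 3 := by rw [e22, h11]; ring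
      have e33' : A 3 3 = A 0 0 ^ 4 := by rw [e33, e22']; ring
      have e44' : A 4 4 = A 0 0 ^ 5 := by rw [e44, e33']; ring
      have e42' : A 4 2 = A 1 0 * A 2 1 + A 0 0 * A 3 1 - A 0 0 ^ 2 * A 2 0 := by
        linear_combination e42 - A 2 0 * h11
      have e43' : A 4 3 = A 0 0 ^ 2 * (A 0 0 * A 1 0 + A 2 1) := by
        linear_combination e43 + A 0 0 * e32 + A 1 0 * e22'
      exact Or.inr (Or.inr ⟨transposedEntries A, eq_lowerTriangular_five.2
        ⟨ht, rfl, rfl, h11, rfl, rfl, e22', rfl, rfl, e32, e33', rfl, rfl, e42', e43', e44'⟩⟩)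
  · rintro (⟨ρ, h⟩ | ⟨ρ, h⟩ | ⟨ρ, h⟩) <;>
    · rw [eq_lowerTriangular_five] at h
      obtain ⟨ht, h⟩ := h
      refine ⟨ht, ?_⟩; and_intros <;> simp only [h] <;> ring

theorem isMultStructureMatrix_mu0_five
    (A : Matrix (Fin 6) (Fin 6) K) :
      IsMultStructureMatrix (mu0 K 5) A ↔
        (∃ ρ : ℕ → ℕ → K, ρ 0 0 ≠ 0 ∧ A = !![ρ 0 0, 0, 0, 0, 0, 0; ρ 0 1, ρ 2 2 / ρ 0 0, 0, 0, 0,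
          0; ρ 0 2, ρ 2 3 / ρ 0 0, ρ 2 2, 0, 0, 0; ρ 0 3, ρ 2 4 / ρ 0 0, ρ 2 3, ρ 0 0 * ρ 2 2, 0,
          0; ρ 0 4, ρ 1 4, ρ 2 4, ρ 2 3 * ρ 0 0, ρ 2 2 * ρ 0 0 ^ 2, 0; ρ 0 5, ρ 1 5, ρ 1 4 *
          ρ 0 0, ρ 2 4 * ρ 0 0, ρ 2 3 * ρ 0 0 ^ 2, ρ 0 0 ^ 3 * ρ 2 2]) ∨
        (∃ ρ : ℕ → ℕ → K, A = !![0, 0, 0, 0, 0, 0; ρ 0 1, ρ 1 1, 0, 0, 0, 0; ρ 0 2, ρ 1 2, 0, 0,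
          0, 0; ρ 0 3, ρ 1 3, 0, 0, 0, 0; ρ 0 4, ρ 1 4, 0, 0, 0, 0; ρ 0 5, ρ 1 5, 0, 0, 0, 0]) := by
  rw [isMultStructureMatrix_six_iff (p := 0) (q := 0) (c := 0) (d := 0) (e := 0) isAdapted_mu0
    fun x y => by rw [mu0_five]; simp]
  constructor
  · rintro ⟨ht, e22, e32, e42, e52, e33, e43, e53, e44, e54, e55, -⟩
    simp only [zero_mul, add_zero, sub_zero] at e42 e52 e43 e53 e54 e55
    by_cases h0 : A 0 0 = 0
    · rw [h0, zero_mul] at e22 e32 e42 e52 e33 e43 e53 e44 e54 e55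
      exact Or.inr ⟨transposedEntries A, eq_lowerTriangular_six.2
        ⟨ht, h0, rfl, rfl, rfl, rfl, e22, rfl, rfl, e32, e33, rfl, rfl, e42, e43, e44,
          rfl, rfl, e52, e53, e54, e55⟩⟩
    · have e11 : A 1 1 = A 2 2 / A 0 0 := by rw [e22, mul_div_cancel_left₀ _ h0]
      have e21 : A 2 1 = A 3 2 / A 0 0 := by rw [e32, mul_div_cancel_left₀ _ h0]
      have e31 : A 3 1 = A 4 2 / A 0 0 := by rw [e42, mul_div_cancel_left₀ _ h0]
      have e43' : A 4 3 = A 3 2 * A 0 0 := by rw [e43, mul_comm]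
      have e44' : A 4 4 = A 2 2 * A 0 0 ^ 2 := by rw [e44, e33]; ring
      have e52' : A 5 2 = A 4 1 * A 0 0 := by rw [e52, mul_comm]
      have e53' : A 5 3 = A 4 2 * A 0 0 := by rw [e53, mul_comm]
      have e54' : A 5 4 = A 3 2 * A 0 0 ^ 2 := by rw [e54, e43]; ring
      have e55' : A 5 5 = A 0 0 ^ 3 * A 2 2 := by rw [e55, e44']; ring
      exact Or.inl ⟨transposedEntries A, h0, eq_lowerTriangular_six.2
        ⟨ht, rfl, rfl, e11, rfl, e21, rfl, rfl, e31, rfl, e33, rfl, rfl, rfl, e43', e44',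
          rfl, rfl, e52', e53', e54', e55'⟩⟩
  · rintro (⟨ρ, h0, h⟩ | ⟨ρ, h⟩)
    · rw [eq_lowerTriangular_six] at h
      obtain ⟨ht, h⟩ := h
      refine ⟨ht, ?_⟩; and_intros <;> simp only [h] <;>
        field_simp <;> ring
    · rw [eq_lowerTriangular_six] at h
      obtain ⟨ht, h⟩ := h
      refine ⟨ht, ?_⟩; and_intros <;> simp only [h] <;> ring

theorem isMultStructureMatrix_mu0_five_add_psi_add_psi_of_eq_zero [CharZero K] (h00 : C 0 0 = 1)
    (hC : ∀ q p : ℤ, q < p → C q p = 0) (hd : C 1 1 = 0) {s : K} (hs : s ^ 2 = 5)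
    (A : Matrix (Fin 6) (Fin 6) K) :
      IsMultStructureMatrix (mu0 K 5 + psi C 5 1 4 + psi C 5 2 5) A ↔
        (∃ ρ : ℕ → ℕ → K, A = !![0, 0, 0, 0, 0, 0; ρ 0 1, ρ 1 1, 0, 0, 0, 0; ρ 0 2, -(C 1 0 *
          ρ 1 1), 0, 0, 0, 0; ρ 0 3, ρ 1 3, 0, 0, 0, 0; ρ 0 4, ρ 1 4, -(ρ 1 1 * (C 1 0 * ρ 0 1 +
          ρ 0 2)), 0, 0, 0; ρ 0 5, ρ 1 5, ρ 1 3 * (C 1 0 * ρ 0 1 + ρ 0 2), 0, 0, 0]) ∨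
        (∃ ρ : ℕ → ℕ → K, ρ 3 5 = ((3 + s) * ρ 1 3 - (4 + 2 * s) * ρ 0 2 - (4 + 2 * s) * (C 1 0 +
          1) * ρ 0 1) / 2 ∧ ρ 2 5 = (-(3 + s) * ρ 0 3 + 2 * (C 1 0 * ρ 0 1 + ρ 0 2) * ρ 1 3 - (1 +
          s) * ρ 1 4) / 2 ∧ A = !![-(1 + s) / 2, 0, 0, 0, 0, 0; ρ 0 1, 0, 0, 0, 0, 0; ρ 0 2, (3 +
          s) / 2, 0, 0, 0, 0; ρ 0 3, ρ 1 3, -2 - s, 0, 0, 0; ρ 0 4, ρ 1 4, ((3 + s) * ρ 0 1 - (1 +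
          s) * ρ 1 3) / 2, (7 + 3 * s) / 2, 0, 0; ρ 0 5, ρ 1 5, ρ 2 5, ρ 3 5, -(11 + 5 * s) / 2,
          0]) ∨
        (∃ ρ : ℕ → ℕ → K, ρ 3 5 = ((3 - s) * ρ 1 3 - (4 - 2 * s) * ρ 0 2 - (4 - 2 * s) * (C 1 0 +
          1) * ρ 0 1) / 2 ∧ ρ 2 5 = (-(3 - s) * ρ 0 3 + 2 * (C 1 0 * ρ 0 1 + ρ 0 2) * ρ 1 3 - (1 -
          s) * ρ 1 4) / 2 ∧ A = !![-(1 - s) / 2, 0, 0, 0, 0, 0; ρ 0 1, 0, 0, 0, 0, 0; ρ 0 2, (3 -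
          s) / 2, 0, 0, 0, 0; ρ 0 3, ρ 1 3, -2 + s, 0, 0, 0; ρ 0 4, ρ 1 4, ((3 - s) * ρ 0 1 - (1 -
          s) * ρ 1 3) / 2, (7 - 3 * s) / 2, 0, 0; ρ 0 5, ρ 1 5, ρ 2 5, ρ 3 5, -(11 - 5 * s) / 2,
          0]) := by
  rw [isMultStructureMatrix_six_iff (p := 1) (q := 0) (c := C 1 0) (d := C 1 1) (e := 1)
    ((isAdapted_mu0.add_psi C (by decide)).add_psi C (by decide)) fun x y => by
      simp only [LinearMap.add_apply, mu0_five, psi_five_one_four h00, psi_five_two_five h00 hC]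
      simp [mul_comm, sub_eq_add_neg, add_assoc]]
  simp only [hd]
  constructor
  · rintro ⟨ht, e22, e32, e42, e52, e33, e43, e53, e44, e54, e55, m4, m5, m13, -, m23, j2, j3⟩
    simp only [zero_mul, mul_zero, add_zero, sub_zero, zero_add, one_mul, mul_one, neg_eq_zero]
      at e52 e42 e43 e53 e54 e55 m4 m5 m13 m23 j2 j3
    rw [j3, mul_zero] at e44
    rw [e44, mul_zero] at e55
    -- With `d = 0`, the second Hom-Jacobi equation says `A 3 3 = 0`, and the diagonal recursion
    -- gives `A 3 3 = A 0 0 ^ 2 * A 1 1`.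
    have key : A 0 0 ^ 2 * A 1 1 = 0 := by
      linear_combination j3 - e33 - A 0 0 * e22
    by_cases h0 : A 0 0 = 0
    · rw [h0, zero_mul] at e22 e32 e42 e52 e43 e53 e54
      have e21 : A 2 1 = -(C 1 0 * A 1 1) := by linear_combination h0 - j2 - e32
      have e42' : A 4 2 = -(A 1 1 * (C 1 0 * A 1 0 + A 2 0)) := by
        rw [e42, e21]; ring
      have e52' : A 5 2 = A 3 1 * (C 1 0 * A 1 0 + A 2 0) := by
        rw [e52, e21]; ring
      have e43' : A 4 3 = 0 := by rw [e43, e22, mul_zero, zero_add]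
      have e53' : A 5 3 = 0 := by rw [e53, e22, e32]; ring
      have e54' : A 5 4 = 0 := by rw [e54, j3]; ring
      exact Or.inl ⟨transposedEntries A, eq_lowerTriangular_six.2
        ⟨ht, h0, rfl, rfl, rfl, e21, e22, rfl, rfl, e32, j3, rfl, rfl, e42', e43', e44,
          rfl, rfl, e52', e53', e54', e55⟩⟩
    · have h11 : A 1 1 = 0 := (mul_eq_zero.1 key).resolve_left (pow_ne_zero 2 h0)
      rw [h11, mul_zero] at e22
      replace e33 := j3
      have hj : A 2 1 * (1 + A 0 0) = A 0 0 := by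
        linear_combination -j2 - e32 - C 1 0 * h11
      have h21' : A 2 1 ≠ 0 := fun h => h0 (by rw [← hj, h, zero_mul])
      -- The pairs `(x_0, x_4)` and `(x_1, x_2)` give `A 5 4` as `A 0 0 ^ 3 * A 2 1` and as `A 0 0 *
      -- A 2 1 ^ 2`.
      have h21 : A 2 1 = A 0 0 ^ 2 := by
        refine mul_left_cancel₀ (mul_ne_zero h0 h21') ?_
        linear_combination e54 - m5 - A 2 1 * e32 + A 0 0 * e43 + A 0 0 ^ 2 * e32
          + (A 0 0 * A 1 0 + A 3 1) * e22 - C 1 0 * A 3 2 * h11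
          + (C 1 0 * A 1 0 + A 2 0) * e33
      have hq : A 0 0 * (1 + A 0 0) = 1 := by
        refine mul_left_cancel₀ h0 ?_
        rw [h21] at hj
        linear_combination hj
      -- The polynomial `t ^ 2 + t - 1` has discriminant 5, so `s` splits it. The two branches are
      -- exchanged by `s ↦ -s`.
      have hf : (A 0 0 + (1 + s) / 2) * (A 0 0 + (1 - s) / 2) = 0 := by
        linear_combination hq - hs / 4
      rcases mul_eq_zero.1 hf with hr | hr
      · replace hr : A 0 0 = -(1 + s) / 2 := by linear_combination hr
        have e21 : A 2 1 = (3 + s) / 2 := by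
          rw [h21, hr]; linear_combination hs / 4
        have e32' : A 3 2 = -2 - s := by
          rw [e32, hr, e21]; linear_combination -hs / 4
        have e43' : A 4 3 = (7 + 3 * s) / 2 := by
          rw [e43, hr, e32', e22]; linear_combination hs / 2
        have e54' : A 5 4 = -(11 + 5 * s) / 2 := by
          rw [e54, hr, e43', e33]; linear_combination -3 / 4 * hs
        have e42' : A 4 2 = ((3 + s) * A 1 0 - (1 + s) * A 3 1) / 2 := by
          rw [e42, hr, e21, h11]; ring
        have e53' : A 5 3 = ((3 + s) * A 3 1 - (4 + 2 * s) * A 2 0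
            - (4 + 2 * s) * (C 1 0 + 1) * A 1 0) / 2 := by
          rw [e53, hr, e42', e32', e22]; linear_combination (A 3 1 - A 1 0) / 4 * hs
        have e52' : A 5 2 = (-(3 + s) * A 3 0 + 2 * (C 1 0 * A 1 0 + A 2 0) * A 3 1
            - (1 + s) * A 4 1) / 2 := by
          rw [e52, hr, e21, h11]; ring
        exact Or.inr <| Or.inl ⟨transposedEntries A, e53', e52', eq_lowerTriangular_six.2
          ⟨ht, hr, rfl, h11, rfl, e21, e22, rfl, rfl, e32', e33, rfl, rfl, e42', e43', e44,
            rfl, rfl, rfl, rfl, e54', e55⟩⟩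
      · replace hr : A 0 0 = -(1 - s) / 2 := by linear_combination hr
        have e21 : A 2 1 = (3 - s) / 2 := by
          rw [h21, hr]; linear_combination hs / 4
        have e32' : A 3 2 = -2 + s := by
          rw [e32, hr, e21]; linear_combination -hs / 4
        have e43' : A 4 3 = (7 - 3 * s) / 2 := by
          rw [e43, hr, e32', e22]; linear_combination hs / 2
        have e54' : A 5 4 = -(11 - 5 * s) / 2 := by
          rw [e54, hr, e43', e33]; linear_combination -3 / 4 * hs
        have e42' : A 4 2 = ((3 - s) * A 1 0 - (1 - s) * A 3 1) / 2 := by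
          rw [e42, hr, e21, h11]; ring
        have e53' : A 5 3 = ((3 - s) * A 3 1 - (4 - 2 * s) * A 2 0
            - (4 - 2 * s) * (C 1 0 + 1) * A 1 0) / 2 := by
          rw [e53, hr, e42', e32', e22]; linear_combination (A 3 1 - A 1 0) / 4 * hs
        have e52' : A 5 2 = (-(3 - s) * A 3 0 + 2 * (C 1 0 * A 1 0 + A 2 0) * A 3 1
            - (1 - s) * A 4 1) / 2 := by
          rw [e52, hr, e21, h11]; ring
        exact Or.inr <| Or.inr ⟨transposedEntries A, e53', e52', eq_lowerTriangular_six.2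
          ⟨ht, hr, rfl, h11, rfl, e21, e22, rfl, rfl, e32', e33, rfl, rfl, e42', e43', e44,
            rfl, rfl, rfl, rfl, e54', e55⟩⟩
  · rintro (⟨ρ, h⟩ | ⟨ρ, r35, r25, h⟩ | ⟨ρ, r35, r25, h⟩) <;>
      rw [eq_lowerTriangular_six] at h <;> obtain ⟨ht, h⟩ := h
    · refine ⟨ht, ?_⟩; and_intros <;> simp only [h] <;> ring
    · refine ⟨ht, ?_⟩; and_intros <;> simp only [h, r35, r25] <;> ring_nf <;> simp only [hs] <;> ring
    · refine ⟨ht, ?_⟩; and_intros <;> simp only [h, r35, r25] <;> ring_nf <;> simp only [hs] <;> ring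

theorem isMultStructureMatrix_mu0_five_add_psi_add_psi_of_ne_zero [CharZero K] (h00 : C 0 0 = 1)
    (hC : ∀ q p : ℤ, q < p → C q p = 0) (hd : C 1 1 ≠ 0) {s : K} (hs : s ^ 2 = 5)
    (A : Matrix (Fin 6) (Fin 6) K) :
      IsMultStructureMatrix (mu0 K 5 + psi C 5 1 4 + psi C 5 2 5) A ↔
        (∃ ρ : ℕ → ℕ → K, A = !![0, 0, 0, 0, 0, 0; ρ 0 1, 0, 0, 0, 0, 0; ρ 0 2, -(C 1 1 * ρ 0 1),
          0, 0, 0, 0; ρ 0 3, ρ 1 3, 0, 0, 0, 0; ρ 0 4, ρ 1 4, -(C 1 1 * ρ 0 1 ^ 2), 0, 0, 0;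
          ρ 0 5, ρ 1 5, (C 1 0 * ρ 0 1 + ρ 0 2) * ρ 1 3 + C 1 1 * ρ 0 1 * (ρ 0 3 - ρ 1 4),
          C 1 1 ^ 2 * ρ 0 1 ^ 3, 0, 0]) ∨
        (∃ ρ : ℕ → ℕ → K, A = !![C 1 1 * ρ 0 1, 0, 0, 0, 0, 0; ρ 0 1, 0, 0, 0, 0, 0; ρ 0 2, 0, 0,
          0, 0, 0; ρ 0 3, ρ 1 3, 0, 0, 0, 0; ρ 0 4, ρ 1 4, C 1 1 * ρ 0 1 * ρ 1 3, 0, 0, 0; ρ 0 5,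
          ρ 1 5, (C 1 0 * ρ 0 1 + ρ 0 2) * ρ 1 3, 0, 0, 0]) ∨
        (∃ ρ : ℕ → ℕ → K, ρ 0 0 = -(1 + s) / 2 ∧ ρ 1 2 = ρ 0 0 * (ρ 0 0 - C 1 1 * ρ 0 1) ∧ ρ 2 4 =
          ρ 0 0 * ρ 1 3 + ρ 0 1 * ρ 1 2 ∧ A = !![ρ 0 0, 0, 0, 0, 0, 0; ρ 0 1, 0, 0, 0, 0, 0;
          ρ 0 2, ρ 1 2, 0, 0, 0, 0; ρ 0 3, ρ 1 3, ρ 0 0 * ρ 1 2, 0, 0, 0; ρ 0 4, ρ 1 4, ρ 2 4,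
          ρ 0 0 ^ 2 * ρ 1 2, 0, 0; ρ 0 5, ρ 1 5, (ρ 0 0 - C 1 1 * ρ 0 1) * ρ 1 4 + (C 1 0 * ρ 0 1
          + ρ 0 2) * ρ 1 3 - ρ 0 3 * ρ 1 2, (ρ 0 0 - C 1 1 * ρ 0 1) * ρ 2 4 + (C 1 0 * ρ 0 1 +
          ρ 0 2) * (ρ 0 0 * ρ 1 2), ρ 0 0 * ρ 1 2 ^ 2, 0]) ∨
        (∃ ρ : ℕ → ℕ → K, ρ 0 0 = -(1 - s) / 2 ∧ ρ 1 2 = ρ 0 0 * (ρ 0 0 - C 1 1 * ρ 0 1) ∧ ρ 2 4 =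
          ρ 0 0 * ρ 1 3 + ρ 0 1 * ρ 1 2 ∧ A = !![ρ 0 0, 0, 0, 0, 0, 0; ρ 0 1, 0, 0, 0, 0, 0;
          ρ 0 2, ρ 1 2, 0, 0, 0, 0; ρ 0 3, ρ 1 3, ρ 0 0 * ρ 1 2, 0, 0, 0; ρ 0 4, ρ 1 4, ρ 2 4,
          ρ 0 0 ^ 2 * ρ 1 2, 0, 0; ρ 0 5, ρ 1 5, (ρ 0 0 - C 1 1 * ρ 0 1) * ρ 1 4 + (C 1 0 * ρ 0 1
          + ρ 0 2) * ρ 1 3 - ρ 0 3 * ρ 1 2, (ρ 0 0 - C 1 1 * ρ 0 1) * ρ 2 4 + (C 1 0 * ρ 0 1 +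
          ρ 0 2) * (ρ 0 0 * ρ 1 2), ρ 0 0 * ρ 1 2 ^ 2, 0]) ∨
        (∃ ρ : ℕ → ℕ → K, ρ 0 0 ^ 2 = C 1 1 ∧ ρ 0 1 = (1 - ρ 0 0) / ρ 0 0 ∧ (1 + ρ 0 0) * ρ 1 2 =
          ρ 0 0 ^ 2 * (1 - C 1 0) ∧ ρ 2 4 = ρ 0 0 * ρ 1 3 + ρ 0 1 * ρ 1 2 - ρ 0 0 ^ 2 * ρ 0 2 ∧
          ρ 4 5 = ρ 0 0 * (ρ 1 2 ^ 2 + C 1 0 * ρ 0 0 ^ 2 * ρ 1 2 - ρ 0 0 ^ 3 * ρ 2 4 - ρ 0 0 ^ 2 *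
          ρ 1 3) ∧ ρ 4 5 = ρ 0 0 ^ 4 * (1 - ρ 0 0 + ρ 1 2 + C 1 0 * ρ 0 1 + ρ 0 2) ∧ A = !![ρ 0 0,
          0, 0, 0, 0, 0; ρ 0 1, ρ 0 0 ^ 2, 0, 0, 0, 0; ρ 0 2, ρ 1 2, ρ 0 0 ^ 3, 0, 0, 0; ρ 0 3,
          ρ 1 3, ρ 0 0 * ρ 1 2, ρ 0 0 ^ 4, 0, 0; ρ 0 4, ρ 1 4, ρ 2 4, ρ 0 0 ^ 2 * (1 - ρ 0 0 +
          ρ 1 2), ρ 0 0 ^ 5, 0; ρ 0 5, ρ 1 5, ρ 0 0 ^ 2 * (ρ 1 4 - C 1 0 * ρ 0 3 + ρ 0 0 ^ 2 *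
          ρ 0 4) + (C 1 0 * ρ 0 1 + ρ 0 2) * ρ 1 3 - ρ 0 3 * ρ 1 2, ρ 0 0 ^ 2 * ρ 2 4 + ρ 0 0 *
          ρ 1 2 * (C 1 0 * ρ 0 1 + ρ 0 2) - ρ 0 0 ^ 3 * ρ 0 3, ρ 4 5, ρ 0 0 ^ 7]) := by
  rw [isMultStructureMatrix_six_iff (p := 1) (q := 0) (c := C 1 0) (d := C 1 1) (e := 1)
    ((isAdapted_mu0.add_psi C (by decide)).add_psi C (by decide)) fun x y => by
      simp only [LinearMap.add_apply, mu0_five, psi_five_one_four h00, psi_five_two_five h00 hC]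
      simp [mul_comm, sub_eq_add_neg, add_assoc]]
  constructor
  · rintro ⟨ht, e22, e32, e42, e52, e33, e43, e53, e44, e54, e55, m4, m5, m13, d5, m23, j2, j3⟩
    simp only [zero_mul, mul_zero, add_zero, zero_add, one_mul, mul_one]
      at e52 e42 e43 e53 e54 e55 m4 m5 m13 m23 j2 j3
    -- Now `A 3 3 = d * A 1 1` is compared with `A 3 3 = A 0 0 ^ 2 * A 1 1`: the factor `A 1 1`
    -- leads to the first four families, the other one to the fifth.
    have key : A 1 1 * (A 0 0 ^ 2 - C 1 1) = 0 := by
      linear_combination -j3 - e33 - A 0 0 * e22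
    by_cases h11 : A 1 1 = 0
    · rw [h11, mul_zero] at e22
      rw [e22, mul_zero] at e33
      rw [e33, mul_zero] at e44
      have e55' : A 5 5 = 0 := by rw [e55, e44]; ring
      have e42' : A 4 2 = A 0 0 * A 3 1 + A 1 0 * A 2 1 := by rw [e42, h11]; ring
      have e43' : A 4 3 = A 0 0 ^ 2 * A 2 1 := by rw [e43, e32, e22]; ring
      have hj : A 0 0 - C 1 1 * A 1 0 = A 2 1 * (1 + A 0 0) := by
        linear_combination j2 + e32 + C 1 0 * h11
      have e52' : A 5 2 = (A 0 0 - C 1 1 * A 1 0) * A 4 1 + (C 1 0 * A 1 0 + A 2 0) * A 3 1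
          - A 3 0 * A 2 1 := by
        rw [e52, h11]; ring
      have e53' : A 5 3 = (A 0 0 - C 1 1 * A 1 0) * A 4 2
          + (C 1 0 * A 1 0 + A 2 0) * (A 0 0 * A 2 1) := by
        rw [e53, e32, e22]; ring
      have e54' : A 5 4 = A 0 0 * A 2 1 ^ 2 := by
        rw [m5, e32, e22, h11]; ring
      -- The two values of `A 5 4` are compared. The cases `A 0 0 = 0` and `A 2 1 = 0` give families
      -- 1 and 2; the last factor together with `hj` yields the quadratic for `A 0 0` again.
      have key2 : A 0 0 * A 2 1 * (A 2 1 - A 0 0 * (A 0 0 - C 1 1 * A 1 0)) = 0 := by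
        rw [e54, e43', e33] at e54'
        linear_combination -e54'
      by_cases h0 : A 0 0 = 0
      · have e21 : A 2 1 = -(C 1 1 * A 1 0) := by
          rw [h0] at hj; linear_combination -hj
        rw [h0, zero_mul] at e32
        have e42' : A 4 2 = -(C 1 1 * A 1 0 ^ 2) := by rw [e42', h0, e21]; ring
        rw [h0] at e43' e54' e52' e53'
        have e43' : A 4 3 = 0 := by rw [e43']; ring
        have e54' : A 5 4 = 0 := by rw [e54']; ring
        have e52' : A 5 2 = (C 1 0 * A 1 0 + A 2 0) * A 3 1
            + C 1 1 * A 1 0 * (A 3 0 - A 4 1) := by rw [e52', e21]; ring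
        have e53' : A 5 3 = C 1 1 ^ 2 * A 1 0 ^ 3 := by rw [e53', e42']; ring
        exact Or.inl ⟨transposedEntries A, eq_lowerTriangular_six.2
          ⟨ht, h0, rfl, h11, rfl, e21, e22, rfl, rfl, e32, e33, rfl, rfl, e42', e43', e44,
            rfl, rfl, e52', e53', e54', e55'⟩⟩
      · by_cases h21 : A 2 1 = 0
        · have h00' : A 0 0 = C 1 1 * A 1 0 := by rw [h21] at hj; linear_combination hj
          rw [← h00', h21] at e52' e53'
          rw [h21] at e42' e43' e54' e32
          rw [mul_zero] at e32 e43'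
          have e42' : A 4 2 = C 1 1 * A 1 0 * A 3 1 := by rw [e42', h00']; ring
          have e54' : A 5 4 = 0 := by rw [e54']; ring
          have e52' : A 5 2 = (C 1 0 * A 1 0 + A 2 0) * A 3 1 := by rw [e52']; ring
          have e53' : A 5 3 = 0 := by rw [e53']; ring
          exact Or.inr <| Or.inl ⟨transposedEntries A, eq_lowerTriangular_six.2
            ⟨ht, h00', rfl, h11, rfl, h21, e22, rfl, rfl, e32, e33, rfl, rfl, e42', e43', e44,
              rfl, rfl, e52', e53', e54', e55'⟩⟩
        · have e21 := sub_eq_zero.1 ((mul_eq_zero.1 key2).resolve_left (mul_ne_zero h0 h21))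
          have hq : A 0 0 * (1 + A 0 0) = 1 := by
            refine mul_left_cancel₀ h21 ?_
            linear_combination -e21 - A 0 0 * hj
          have hf : (A 0 0 + (1 + s) / 2) * (A 0 0 + (1 - s) / 2) = 0 := by
            linear_combination hq - hs / 4
          rcases mul_eq_zero.1 hf with hr | hr
          · replace hr : A 0 0 = -(1 + s) / 2 := by linear_combination hr
            exact Or.inr <| Or.inr <| Or.inl ⟨transposedEntries A, hr, e21, e42',
              eq_lowerTriangular_six.2 ⟨ht, rfl, rfl, h11, rfl, rfl, e22, rfl, rfl, e32, e33,
                rfl, rfl, rfl, e43', e44, rfl, rfl, e52', e53', e54', e55'⟩⟩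
          · replace hr : A 0 0 = -(1 - s) / 2 := by linear_combination hr
            exact Or.inr <| Or.inr <| Or.inr <| Or.inl ⟨transposedEntries A, hr, e21, e42',
              eq_lowerTriangular_six.2 ⟨ht, rfl, rfl, h11, rfl, rfl, e22, rfl, rfl, e32, e33,
                rfl, rfl, rfl, e43', e44, rfl, rfl, e52', e53', e54', e55'⟩⟩
    · have h0d := sub_eq_zero.1 ((mul_eq_zero.1 key).resolve_left h11)
      have h0 : A 0 0 ≠ 0 := fun h => hd (by rw [← h0d, h]; ring)
      have key2 : A 0 0 * A 1 1 * (A 1 1 - A 0 0 ^ 2) = 0 := by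
        linear_combination -m4 + e44 + A 0 0 * e33 + (A 0 0 ^ 2 - A 1 1) * e22
      replace h11 := sub_eq_zero.1 ((mul_eq_zero.1 key2).resolve_left (mul_ne_zero h0 h11))
      have e22' : A 2 2 = A 0 0 ^ 3 := by rw [e22, h11]; ring
      have e33' : A 3 3 = A 0 0 ^ 4 := by rw [e33, e22']; ring
      have e44' : A 4 4 = A 0 0 ^ 5 := by rw [e44, e33']; ring
      have e55' : A 5 5 = A 0 0 ^ 7 := by rw [m23, e22', e33']; ring
      rw [← h0d] at e52 e53 e54 e55 m5 j2
      -- The entry `A 5 5` is `A 0 0 ^ 7` from `[x_2, x_3]` and `(A 0 0 - d * A 1 0) * A 0 0 ^ 5`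
      -- from `[x_0, x_4]`, with `d = A 0 0 ^ 2`.
      have h10 : A 1 0 * A 0 0 = 1 - A 0 0 := by
        rw [e55', e44'] at e55
        refine mul_left_cancel₀ (pow_ne_zero 6 h0) ?_
        linear_combination e55
      have e10 : A 1 0 = (1 - A 0 0) / A 0 0 := eq_div_of_mul_eq h0 h10
      -- This relation is left unsolved for `A 2 1`, since `A 0 0 = -1` is possible when `d = 1`.
      -- Likewise the two expressions for `A 5 4` below remain as a condition on the family.
      have e21 : (1 + A 0 0) * A 2 1 = A 0 0 ^ 2 * (1 - C 1 0) := by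
        linear_combination -j2 - e32 - C 1 0 * h11 - A 0 0 * h10
      have e42' : A 4 2 = A 0 0 * A 3 1 + A 1 0 * A 2 1 - A 0 0 ^ 2 * A 2 0 := by
        rw [e42, h11]; ring
      have e43' : A 4 3 = A 0 0 ^ 2 * (1 - A 0 0 + A 2 1) := by
        rw [e43, e32, e22']; linear_combination A 0 0 ^ 2 * h10
      have e52' : A 5 2 = A 0 0 ^ 2 * (A 4 1 - C 1 0 * A 3 0 + A 0 0 ^ 2 * A 4 0)
          + (C 1 0 * A 1 0 + A 2 0) * A 3 1 - A 3 0 * A 2 1 := by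
        rw [e52, h11]; linear_combination -A 0 0 * A 4 1 * h10
      have e53' : A 5 3 = A 0 0 ^ 2 * A 4 2 + A 0 0 * A 2 1 * (C 1 0 * A 1 0 + A 2 0)
          - A 0 0 ^ 3 * A 3 0 := by
        rw [e53, e32, e22']; linear_combination -A 0 0 * A 4 2 * h10
      have e54' : A 5 4 = A 0 0 ^ 4 * (1 - A 0 0 + A 2 1 + C 1 0 * A 1 0 + A 2 0) := by
        rw [e54, e43', e33']
        linear_combination -A 0 0 ^ 3 * (1 - A 0 0 + A 2 1) * h10
      have m5' : A 5 4 = A 0 0 * (A 2 1 ^ 2 + C 1 0 * A 0 0 ^ 2 * A 2 1 - A 0 0 ^ 3 * A 4 2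
          - A 0 0 ^ 2 * A 3 1) := by
        rw [m5, e32, e22', h11]; ring
      exact Or.inr <| Or.inr <| Or.inr <| Or.inr ⟨transposedEntries A, h0d, e10, e21, e42', m5',
        e54', eq_lowerTriangular_six.2 ⟨ht, rfl, rfl, h11, rfl, rfl, e22', rfl, rfl, e32, e33',
          rfl, rfl, rfl, e43', e44', rfl, rfl, e52', e53', rfl, e55'⟩⟩
  · rintro (⟨ρ, h⟩ | ⟨ρ, h⟩ | ⟨ρ, r00, r12, r24, h⟩ | ⟨ρ, r00, r12, r24, h⟩ |
      ⟨ρ, rd, r01, r12, r24, r45, r45', h⟩) <;>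
      rw [eq_lowerTriangular_six] at h <;> obtain ⟨ht, h⟩ := h
    · refine ⟨ht, ?_⟩; and_intros <;> simp only [h] <;> ring
    · refine ⟨ht, ?_⟩; and_intros <;> simp only [h] <;> ring
    -- Only this quadratic relation is needed from the value of `ρ 0 0`; it enters in the first
    -- Hom-Jacobi equation.
    · have hq : ρ 0 0 ^ 2 = 1 - ρ 0 0 := by rw [r00]; linear_combination hs / 4
      refine ⟨ht, ?_⟩; and_intros <;> simp only [h] <;> try ring1
      · linear_combination r24
      · linear_combination ρ 0 0 * ρ 1 2 * r12
      · linear_combination -(1 + ρ 0 0) * r12 - (ρ 0 0 - C 1 1 * ρ 0 1) * hq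
    · have hq : ρ 0 0 ^ 2 = 1 - ρ 0 0 := by rw [r00]; linear_combination hs / 4
      refine ⟨ht, ?_⟩; and_intros <;> simp only [h] <;> try ring1
      · linear_combination r24
      · linear_combination ρ 0 0 * ρ 1 2 * r12
      · linear_combination -(1 + ρ 0 0) * r12 - (ρ 0 0 - C 1 1 * ρ 0 1) * hq
    · have h0 : ρ 0 0 ≠ 0 := fun h => hd (by rw [← rd, h]; ring)
      have h10 : ρ 0 1 * ρ 0 0 = 1 - ρ 0 0 := by rw [r01, div_mul_cancel₀ _ h0]
      simp only [← rd]
      refine ⟨ht, ?_⟩; and_intros <;> simp only [h] <;> try ring1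
      · linear_combination r24
      · linear_combination ρ 0 0 * ρ 1 4 * h10
      · linear_combination -ρ 0 0 ^ 2 * h10
      · linear_combination ρ 0 0 * ρ 2 4 * h10
      · linear_combination r45' + ρ 0 0 ^ 3 * (1 - ρ 0 0 + ρ 1 2) * h10
      · linear_combination ρ 0 0 ^ 6 * h10
      · linear_combination r45
      -- The equation of the pair `(x_1, x_3)` is a multiple of the relation on `ρ 1 2`, so it adds
      -- no condition to the family.
      · linear_combination ρ 0 0 ^ 4 * (ρ 0 0 - 1) * r12
      · linear_combination -r12 - ρ 0 0 * h10

theorem isMultStructureMatrix_mu0_five_add_psi_one_four_of_ne (h00 : C 0 0 = 1)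
    (h0 : C 1 0 ≠ 0) (h1 : C 1 0 ≠ 1)
    (A : Matrix (Fin 6) (Fin 6) K) :
      IsMultStructureMatrix (mu0 K 5 + psi C 5 1 4) A ↔
        (∃ ρ : ℕ → ℕ → K, A = !![0, 0, 0, 0, 0, 0; ρ 0 1, 0, 0, 0, 0, 0; ρ 0 2, ρ 1 2, 0, 0, 0, 0;
          ρ 0 3, ρ 1 3, 0, 0, 0, 0; ρ 0 4, ρ 1 4, ρ 0 1 * ρ 1 2, 0, 0, 0; ρ 0 5, ρ 1 5, C 1 0 *
          ρ 0 1 * ρ 1 3, 0, 0, 0]) ∨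
        (∃ ρ : ℕ → ℕ → K, ρ 3 5 = ((1 + C 1 0) * ρ 0 1 ^ 2 + (-1 + C 1 0) * ρ 2 4) / ((-1 + C 1 0)
          * C 1 0) ∧ ρ 2 5 = (-(ρ 0 3) + ρ 1 4 + ρ 1 3 * ρ 0 1 * C 1 0 ^ 2) / C 1 0 ∧ ρ 0 2 =
          ((C 1 0 ^ 2 - C 1 0 ^ 3) * ρ 2 4 + C 1 0 * ρ 0 1 ^ 2 + C 1 0 ^ 2 * ρ 0 1 ^ 2 + C 1 0 ^ 2
          * ρ 1 3 - C 1 0 * ρ 1 3) / (-1 + C 1 0) ∧ A = !![1 / C 1 0, 0, 0, 0, 0, 0; ρ 0 1, 1 /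
          C 1 0 ^ 2, 0, 0, 0, 0; ρ 0 2, (1 + C 1 0) * ρ 0 1 / ((-1 + C 1 0) * C 1 0), 1 /
          C 1 0 ^ 3, 0, 0, 0; ρ 0 3, ρ 1 3, (1 + C 1 0) * ρ 0 1 / ((-1 + C 1 0) * C 1 0 ^ 2), 1 /
          C 1 0 ^ 4, 0, 0; ρ 0 4, ρ 1 4, ρ 2 4, 2 * ρ 0 1 / ((-1 + C 1 0) * C 1 0 ^ 2), 1 /
          C 1 0 ^ 5, 0; ρ 0 5, ρ 1 5, ρ 2 5, ρ 3 5, (1 + C 1 0) * ρ 0 1 / ((-1 + C 1 0) *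
          C 1 0 ^ 3), 1 / C 1 0 ^ 6]) := by
  rw [isMultStructureMatrix_six_iff (p := 1) (q := 0) (c := C 1 0) (d := 0) (e := 0)
    (isAdapted_mu0.add_psi C (by decide)) fun x y => by
      rw [LinearMap.add_apply, LinearMap.add_apply, mu0_five, psi_five_one_four h00]
      simp [mul_comm]]
  constructor
  · rintro ⟨ht, e22, e32, e42, e52, e33, e43, e53, e44, e54, e55, m4, m5, m13, -, -, j2, -⟩
    simp only [zero_mul, add_zero, sub_zero, one_mul, mul_one, mul_zero, zero_add, neg_zero]
      at e42 e52 e43 e53 e54 e55 m4 m5 m13 j2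
    have key : A 0 0 * A 1 1 * (A 1 1 - A 0 0 ^ 2) = 0 := by
      linear_combination -m4 + e44 + A 0 0 * e33 + (A 0 0 ^ 2 - A 1 1) * e22
    by_cases h0' : A 0 0 = 0
    · have h11 : A 1 1 = 0 :=
        (mul_eq_zero.1 (by linear_combination h0' - j2 : C 1 0 * A 1 1 = 0)).resolve_left h0
      rename' h0 => hc, h0' => h0
      rw [h0, zero_mul] at e22 e32 e42 e52 e33 e43 e53 e44 e54 e55
      have e42' : A 4 2 = A 1 0 * A 2 1 := by linear_combination e42 - A 2 0 * h11
      have e52' : A 5 2 = C 1 0 * A 1 0 * A 3 1 := by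
        linear_combination e52 - C 1 0 * A 3 0 * h11
      have e43' : A 4 3 = 0 := by rw [e43, e22, mul_zero, zero_add]
      have e53' : A 5 3 = 0 := by simp [e53, e32]
      have e54' : A 5 4 = 0 := by simp [e54, e33]
      exact Or.inl ⟨transposedEntries A, eq_lowerTriangular_six.2
        ⟨ht, h0, rfl, h11, rfl, rfl, e22, rfl, rfl, e32, e33, rfl, rfl, e42', e43', e44,
          rfl, rfl, e52', e53', e54', e55⟩⟩
    · have hc1 : -1 + C 1 0 ≠ 0 := fun h => h1 (by linear_combination h)
      have h11' : A 1 1 ≠ 0 := fun h => h0' (by linear_combination j2 + C 1 0 * h)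
      have h11 : A 1 1 = A 0 0 ^ 2 :=
        sub_eq_zero.1 ((mul_eq_zero.1 key).resolve_left (mul_ne_zero h0' h11'))
      -- Hom-Jacobi gives `A 0 0 = c * A 1 1`, which here is `c * A 0 0 ^ 2`.
      have hi : A 0 0 = 1 / C 1 0 := by
        rw [eq_div_iff h0]
        refine mul_left_cancel₀ h0' ?_
        linear_combination -j2 - C 1 0 * h11
      rw [hi] at e22 e32 e42 e52 e33 e43 e53 e44 e54 e55 h11
      have e11 : A 1 1 = 1 / C 1 0 ^ 2 := by rw [h11]; field_simp
      rw [e11] at e22 e42 e52 m5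
      have e22' : A 2 2 = 1 / C 1 0 ^ 3 := by rw [e22]; field_simp
      have e33' : A 3 3 = 1 / C 1 0 ^ 4 := by rw [e33, e22']; field_simp
      have e44' : A 4 4 = 1 / C 1 0 ^ 5 := by rw [e44, e33']; field_simp
      have e55' : A 5 5 = 1 / C 1 0 ^ 6 := by rw [e55, e44']; field_simp
      rw [e22'] at e43
      rw [e33', m5, e43, e32] at e54
      -- Equating the two values of `A 5 4` is linear in `A 2 1`, with coefficient proportional to
      -- `c - 1`; this is where `c ≠ 1` matters.
      have e21 : A 2 1 = (1 + C 1 0) * A 1 0 / ((-1 + C 1 0) * C 1 0) := by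
        field_simp at e54 ⊢
        linear_combination e54
      have e32' : A 3 2 = (1 + C 1 0) * A 1 0 / ((-1 + C 1 0) * C 1 0 ^ 2) := by
        rw [e32, e21]; field_simp
      have e43' : A 4 3 = 2 * A 1 0 / ((-1 + C 1 0) * C 1 0 ^ 2) := by
        rw [e43, e32']; field_simp; ring
      have e54' : A 5 4 = (1 + C 1 0) * A 1 0 / ((-1 + C 1 0) * C 1 0 ^ 3) := by
        rw [m5, e32']; field_simp
      have e53' : A 5 3 = ((1 + C 1 0) * A 1 0 ^ 2 + (-1 + C 1 0) * A 4 2)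
          / ((-1 + C 1 0) * C 1 0) := by
        rw [e53, e32']; field_simp; ring
      have e52' : A 5 2 = (-(A 3 0) + A 4 1 + A 3 1 * A 1 0 * C 1 0 ^ 2) / C 1 0 := by
        rw [e52]; field_simp; ring
      -- The family keeps `ρ 2 4` free, so the equation for `A 4 2` is solved for `A 2 0`, whose
      -- coefficient `A 1 1` is nonzero.
      have e20 : A 2 0 = ((C 1 0 ^ 2 - C 1 0 ^ 3) * A 4 2 + C 1 0 * A 1 0 ^ 2
          + C 1 0 ^ 2 * A 1 0 ^ 2 + C 1 0 ^ 2 * A 3 1 - C 1 0 * A 3 1) / (-1 + C 1 0) := by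
        rw [e42, e21]; field_simp; ring
      exact Or.inr ⟨transposedEntries A, e53', e52', e20, eq_lowerTriangular_six.2
        ⟨ht, hi, rfl, e11, rfl, e21, e22', rfl, rfl, e32', e33', rfl, rfl, rfl, e43', e44',
          rfl, rfl, rfl, rfl, e54', e55'⟩⟩
  · rintro (⟨ρ, h⟩ | ⟨ρ, r35, r25, r02, h⟩) <;>
      rw [eq_lowerTriangular_six] at h <;> obtain ⟨ht, h⟩ := h
    · refine ⟨ht, ?_⟩; and_intros <;> simp only [h] <;> ring
    · have hc1 : -1 + C 1 0 ≠ 0 := fun h => h1 (by linear_combination h)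
      refine ⟨ht, ?_⟩; and_intros <;> simp only [h, r35, r25, r02] <;>
        field_simp <;> ring

theorem isMultStructureMatrix_mu0_five_add_psi_one_four_of_eq_one [CharZero K] (h00 : C 0 0 = 1) (hc : C 1 0 = 1)
    (A : Matrix (Fin 6) (Fin 6) K) :
      IsMultStructureMatrix (mu0 K 5 + psi C 5 1 4) A ↔
        (∃ ρ : ℕ → ℕ → K, A = !![0, 0, 0, 0, 0, 0; ρ 0 1, 0, 0, 0, 0, 0; ρ 0 2, ρ 1 2, 0, 0, 0, 0;
          ρ 0 3, ρ 1 3, 0, 0, 0, 0; ρ 0 4, ρ 1 4, ρ 0 1 * ρ 1 2, 0, 0, 0; ρ 0 5, ρ 1 5, ρ 0 1 *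
          ρ 1 3, 0, 0, 0]) ∨
        (∃ ρ : ℕ → ℕ → K, A = !![1, 0, 0, 0, 0, 0; 0, 1, 0, 0, 0, 0; ρ 0 2, ρ 1 2, 1, 0, 0, 0;
          ρ 0 3, ρ 1 3, ρ 1 2, 1, 0, 0; ρ 0 4, ρ 1 4, ρ 1 3 - ρ 0 2, ρ 1 2, 1, 0; ρ 0 5, ρ 1 5,
          ρ 1 4 - ρ 0 3, ρ 1 3 - ρ 0 2, ρ 1 2, 1]) := by
  rw [isMultStructureMatrix_six_iff (p := 1) (q := 0) (c := C 1 0) (d := 0) (e := 0)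
    (isAdapted_mu0.add_psi C (by decide)) fun x y => by
      rw [LinearMap.add_apply, LinearMap.add_apply, mu0_five, psi_five_one_four h00]
      simp [mul_comm]]
  simp only [hc]
  constructor
  · rintro ⟨ht, e22, e32, e42, e52, e33, e43, e53, e44, e54, e55, m4, m5, m13, -, -, j2, -⟩
    simp only [zero_mul, add_zero, sub_zero, one_mul, mul_one, mul_zero, zero_add, neg_zero]
      at e42 e52 e43 e53 e54 e55 m4 m5 m13 j2
    have key : A 0 0 * A 1 1 * (A 1 1 - A 0 0 ^ 2) = 0 := by
      linear_combination -m4 + e44 + A 0 0 * e33 + (A 0 0 ^ 2 - A 1 1) * e22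
    by_cases h0 : A 0 0 = 0
    · have h11 : A 1 1 = 0 := by linear_combination h0 - j2
      rw [h0, zero_mul] at e22 e32 e42 e52 e33 e43 e53 e44 e54 e55
      have e42' : A 4 2 = A 1 0 * A 2 1 := by linear_combination e42 - A 2 0 * h11
      have e52' : A 5 2 = A 1 0 * A 3 1 := by
        linear_combination e52 - A 3 0 * h11
      have e43' : A 4 3 = 0 := by rw [e43, e22, mul_zero, zero_add]
      have e53' : A 5 3 = 0 := by simp [e53, e32]
      have e54' : A 5 4 = 0 := by simp [e54, e33]
      exact Or.inl ⟨transposedEntries A, eq_lowerTriangular_six.2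
        ⟨ht, h0, rfl, h11, rfl, rfl, e22, rfl, rfl, e32, e33, rfl, rfl, e42', e43', e44,
          rfl, rfl, e52', e53', e54', e55⟩⟩
    · have h01 : A 1 1 = A 0 0 := by linear_combination -j2
      rw [h01] at key
      have hi : A 0 0 = 1 := by
        refine mul_left_cancel₀ (pow_ne_zero 3 h0) (sub_eq_zero.1 ?_)
        linear_combination -key
      have e11 : A 1 1 = 1 := h01.trans hi
      simp only [hi, e11, one_mul, mul_one] at e22 e32 e42 e52 e33 e43 e53 e44 e54 e55 m5
      rw [e22] at e33 e43
      rw [e33] at e44 e54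
      rw [e44] at e55
      -- For `c = 1` the comparison of the values of `A 5 4` no longer involves `A 2 1`, which
      -- becomes free; it reads `2 * A 1 0 = 0`.
      have e10 : A 1 0 = 0 := by
        have : (2 : K) * A 1 0 = 0 := by linear_combination m5 - e54 - e43
        simpa using this
      simp only [e10, zero_mul, add_zero, mul_one, zero_sub] at e42 e52 e43 e53 e54
      have e43' : A 4 3 = A 2 1 := e43.trans e32
      have e42' : A 4 2 = A 3 1 - A 2 0 := by linear_combination e42
      have e52' : A 5 2 = A 4 1 - A 3 0 := by linear_combination e52
      exact Or.inr ⟨transposedEntries A, eq_lowerTriangular_six.2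
        ⟨ht, hi, e10, e11, rfl, rfl, e22, rfl, rfl, e32, e33, rfl, rfl, e42', e43', e44,
          rfl, rfl, e52', e53.trans e42', e54.trans e43', e55⟩⟩
  · rintro (⟨ρ, h⟩ | ⟨ρ, h⟩) <;>
    · rw [eq_lowerTriangular_six] at h
      obtain ⟨ht, h⟩ := h
      refine ⟨ht, ?_⟩; and_intros <;> simp only [h] <;> ring

theorem isMultStructureMatrix_mu0_five_add_psi_one_five (h00 : C 0 0 = 1)
    (A : Matrix (Fin 6) (Fin 6) K) :
      IsMultStructureMatrix (mu0 K 5 + psi C 5 1 5) A ↔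
        (∃ ρ : ℕ → ℕ → K, ρ 0 0 ≠ 0 ∧ A = !![ρ 0 0, 0, 0, 0, 0, 0; ρ 0 1, 0, 0, 0, 0, 0; ρ 0 2,
          ρ 1 2, 0, 0, 0, 0; ρ 0 3, ρ 2 4 / ρ 0 0, ρ 0 0 * ρ 1 2, 0, 0, 0; ρ 0 4, ρ 1 4, ρ 2 4,
          ρ 1 2 * ρ 0 0 ^ 2, 0, 0; ρ 0 5, ρ 1 5, ρ 1 2 * ρ 0 1 + ρ 1 4 * ρ 0 0, ρ 2 4 * ρ 0 0,
          ρ 1 2 * ρ 0 0 ^ 3, 0]) ∨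
        (∃ ρ : ℕ → ℕ → K, A = !![0, 0, 0, 0, 0, 0; ρ 0 1, ρ 1 1, 0, 0, 0, 0; ρ 0 2, ρ 1 2, 0, 0,
          0, 0; ρ 0 3, ρ 1 3, 0, 0, 0, 0; ρ 0 4, ρ 1 4, 0, 0, 0, 0; ρ 0 5, ρ 1 5, -(ρ 1 1 * ρ 0 2)
          + ρ 0 1 * ρ 1 2, 0, 0, 0]) ∨
        (∃ ρ : ℕ → ℕ → K, ρ 0 0 ≠ 0 ∧ A = !![ρ 0 0, 0, 0, 0, 0, 0; ρ 0 1, ρ 0 0 ^ 3, 0, 0, 0, 0;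
          ρ 0 2, ρ 1 2, ρ 0 0 ^ 4, 0, 0, 0; ρ 0 3, ρ 2 4 / ρ 0 0, ρ 0 0 * ρ 1 2, ρ 0 0 ^ 5, 0, 0;
          ρ 0 4, ρ 1 4, ρ 2 4, ρ 0 0 ^ 2 * ρ 1 2, ρ 0 0 ^ 6, 0; ρ 0 5, ρ 1 5, -(ρ 0 0 ^ 3 * ρ 0 2)
          + ρ 1 4 * ρ 0 0 + ρ 0 1 * ρ 1 2, ρ 0 0 * (ρ 0 0 ^ 3 * ρ 0 1 + ρ 2 4), ρ 0 0 ^ 3 * ρ 1 2,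
          ρ 0 0 ^ 7]) ∨
        (∃ ρ : ℕ → ℕ → K, A = !![ρ 0 0, 0, 0, 0, 0, 0; ρ 0 1, ρ 0 0 ^ 3, 0, 0, 0, 0; ρ 0 2, ρ 1 2,
          ρ 0 0 ^ 4, 0, 0, 0; ρ 0 3, 0, ρ 0 0 * ρ 1 2, ρ 0 0 ^ 5, 0, 0; ρ 0 4, ρ 1 4, 0, ρ 0 0 ^ 2
          * ρ 1 2, ρ 0 0 ^ 6, 0; ρ 0 5, ρ 1 5, -(ρ 0 0 ^ 3 * ρ 0 2) + ρ 1 4 * ρ 0 0 + ρ 0 1 *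
          ρ 1 2, ρ 0 0 ^ 4 * ρ 0 1, ρ 0 0 ^ 3 * ρ 1 2, ρ 0 0 ^ 7]) ∨
        (∃ ρ : ℕ → ℕ → K, A = !![ρ 0 0, 0, 0, 0, 0, 0; ρ 0 1, 0, 0, 0, 0, 0; ρ 0 2, ρ 1 2, 0, 0,
          0, 0; ρ 0 3, 0, ρ 0 0 * ρ 1 2, 0, 0, 0; ρ 0 4, ρ 1 4, 0, ρ 0 0 ^ 2 * ρ 1 2, 0, 0; ρ 0 5,
          ρ 1 5, ρ 1 4 * ρ 0 0 + ρ 0 1 * ρ 1 2, 0, ρ 0 0 ^ 3 * ρ 1 2, 0]) := by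
  rw [isMultStructureMatrix_six_iff (p := 0) (q := 1) (c := 0) (d := 0) (e := 0)
    (isAdapted_mu0.add_psi C (by decide)) fun x y => by
      rw [LinearMap.add_apply, LinearMap.add_apply, mu0_five, psi_five_one_five h00]; simp]
  constructor
  · rintro ⟨ht, e22, e32, e42, e52, e33, e43, e53, e44, e54, e55, -, m5, -⟩
    simp only [zero_mul, add_zero, sub_zero, one_mul, mul_one, mul_zero, zero_add]
      at e42 e52 e43 e53 e54 e55 m5
    -- Here `x_5` is both `[x_0, x_4]` and `[x_1, x_2]`, so `A 0 0 ^ 4 * A 1 1 = A 0 0 * A 1 1 ^ 2`.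
    -- The three factors lead to the first three families, which already exhaust all solutions.
    have key : A 0 0 * A 1 1 * (A 1 1 - A 0 0 ^ 3) = 0 := by
      linear_combination -m5 + e55 + A 0 0 * e44 + A 0 0 ^ 2 * e33 + (A 0 0 ^ 3 - A 1 1) * e22
    by_cases h0 : A 0 0 = 0
    · rw [h0, zero_mul] at e22 e32 e42 e52 e33 e43 e53 e44 e54 e55
      have e52' : A 5 2 = -(A 1 1 * A 2 0) + A 1 0 * A 2 1 := by linear_combination e52
      have e53' : A 5 3 = 0 := by rw [e53, e22, mul_zero, zero_add]
      exact Or.inr (Or.inl ⟨transposedEntries A, eq_lowerTriangular_six.2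
        ⟨ht, h0, rfl, rfl, rfl, rfl, e22, rfl, rfl, e32, e33, rfl, rfl, e42, e43, e44,
          rfl, rfl, e52', e53', e54, e55⟩⟩)
    · have e31 : A 3 1 = A 4 2 / A 0 0 := by rw [e42, mul_div_cancel_left₀ _ h0]
      rcases mul_eq_zero.1 key with key | h11
      · have h11 := (mul_eq_zero.1 key).resolve_left h0
        rw [h11, mul_zero] at e22
        rw [e22, mul_zero] at e33
        rw [e33, mul_zero] at e44
        rw [e44, mul_zero] at e55
        have e43' : A 4 3 = A 2 1 * A 0 0 ^ 2 := by rw [e43, e32]; ring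
        have e52' : A 5 2 = A 2 1 * A 1 0 + A 4 1 * A 0 0 := by
          linear_combination e52 - A 2 0 * h11
        have e53' : A 5 3 = A 4 2 * A 0 0 := by rw [e53, e22]; ring
        have e54' : A 5 4 = A 2 1 * A 0 0 ^ 3 := by rw [e54, e43']; ring
        exact Or.inl ⟨transposedEntries A, h0, eq_lowerTriangular_six.2
          ⟨ht, rfl, rfl, h11, rfl, rfl, e22, rfl, e31, e32, e33, rfl, rfl, rfl, e43', e44,
            rfl, rfl, e52', e53', e54', e55⟩⟩
      · rw [sub_eq_zero] at h11
        have e22' : A 2 2 = A 0 0 ^ 4 := by rw [e22, h11]; ring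
        have e33' : A 3 3 = A 0 0 ^ 5 := by rw [e33, e22']; ring
        have e44' : A 4 4 = A 0 0 ^ 6 := by rw [e44, e33']; ring
        have e55' : A 5 5 = A 0 0 ^ 7 := by rw [e55, e44']; ring
        have e43' : A 4 3 = A 0 0 ^ 2 * A 2 1 := by rw [e43, e32]; ring
        have e52' : A 5 2 = -(A 0 0 ^ 3 * A 2 0) + A 4 1 * A 0 0 + A 1 0 * A 2 1 := by
          rw [e52, h11]; ring
        have e53' : A 5 3 = A 0 0 * (A 0 0 ^ 3 * A 1 0 + A 4 2) := by rw [e53, e22']; ring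
        have e54' : A 5 4 = A 0 0 ^ 3 * A 2 1 := by rw [e54, e43']; ring
        exact Or.inr (Or.inr (Or.inl ⟨transposedEntries A, h0, eq_lowerTriangular_six.2
          ⟨ht, rfl, rfl, h11, rfl, rfl, e22', rfl, e31, e32, e33', rfl, rfl, rfl, e43', e44',
            rfl, rfl, e52', e53', e54', e55'⟩⟩))
  -- The last two families are redundant: for `ρ 0 0 ≠ 0` they are the case `ρ 2 4 = 0` of the third
  -- and the first, and for `ρ 0 0 = 0` they lie in the second.
  · rintro (⟨ρ, h0, h⟩ | ⟨ρ, h⟩ | ⟨ρ, h0, h⟩ | ⟨ρ, h⟩ | ⟨ρ, h⟩) <;>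
      rw [eq_lowerTriangular_six] at h <;> obtain ⟨ht, h⟩ := h
    · refine ⟨ht, ?_⟩; and_intros <;> simp only [h] <;>
        field_simp <;> ring
    · refine ⟨ht, ?_⟩; and_intros <;> simp only [h] <;> ring
    · refine ⟨ht, ?_⟩; and_intros <;> simp only [h] <;>
        field_simp <;> ring
    · refine ⟨ht, ?_⟩; and_intros <;> simp only [h] <;> ring
    · refine ⟨ht, ?_⟩; and_intros <;> simp only [h] <;> ring

end Classification

end HomLie

/-! ### The complete list of structure maps. -/

theorem mainTheorem4 (K : Type*) [Field K] [IsAlgClosed K] [CharZero K]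
    (C : ℤ → ℤ → K) (hC00 : C 0 0 = 1) (hC : ∀ q p : ℤ, q < p → C q p = 0) :
    -- dimension 3, bracket `μ₀`
    (∀ A : Matrix (Fin 3) (Fin 3) K,
      HomLie.IsMultStructureMatrix (HomLie.mu0 K 2) A ↔
        (∃ ρ : ℕ → ℕ → K,
          A = !![ρ 0 0, 0, 0;
               ρ 0 1, ρ 1 1, 0;
               ρ 0 2, ρ 1 2, ρ 0 0 * ρ 1 1]) ∨
        (∃ ρ : ℕ → ℕ → K,
          A = !![0, 0, 0;
               ρ 0 1, ρ 1 1, 0;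
               ρ 0 2, ρ 1 2, 0])) ∧
    -- dimension 4, bracket `μ₀`
    (∀ A : Matrix (Fin 4) (Fin 4) K,
      HomLie.IsMultStructureMatrix (HomLie.mu0 K 3) A ↔
        (∃ ρ : ℕ → ℕ → K, ρ 0 0 ≠ 0 ∧
          A = !![ρ 0 0, 0, 0, 0;
               ρ 0 1, ρ 2 2 / ρ 0 0, 0, 0;
               ρ 0 2, ρ 1 2, ρ 2 2, 0;
               ρ 0 3, ρ 1 3, ρ 1 2 * ρ 0 0, ρ 0 0 * ρ 2 2]) ∨
        (∃ ρ : ℕ → ℕ → K,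
          A = !![0, 0, 0, 0;
               ρ 0 1, ρ 1 1, 0, 0;
               ρ 0 2, ρ 1 2, 0, 0;
               ρ 0 3, ρ 1 3, 0, 0])) ∧
    -- dimension 5, bracket `μ₀`
    (∀ A : Matrix (Fin 5) (Fin 5) K,
      HomLie.IsMultStructureMatrix (HomLie.mu0 K 4) A ↔
        (∃ ρ : ℕ → ℕ → K, ρ 0 0 ≠ 0 ∧
          A = !![ρ 0 0, 0, 0, 0, 0;
               ρ 0 1, ρ 2 2 / ρ 0 0, 0, 0, 0;
               ρ 0 2, ρ 2 3 / ρ 0 0, ρ 2 2, 0, 0;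
               ρ 0 3, ρ 1 3, ρ 2 3, ρ 0 0 * ρ 2 2, 0;
               ρ 0 4, ρ 1 4, ρ 0 0 * ρ 1 3, ρ 0 0 * ρ 2 3, ρ 0 0 ^ 2 * ρ 2 2]) ∨
        (∃ ρ : ℕ → ℕ → K,
          A = !![0, 0, 0, 0, 0;
               ρ 0 1, ρ 1 1, 0, 0, 0;
               ρ 0 2, ρ 1 2, 0, 0, 0;
               ρ 0 3, ρ 1 3, 0, 0, 0;
               ρ 0 4, ρ 1 4, 0, 0, 0])) ∧
    -- dimension 5, bracket `μ₀ + ψ_{1,4}`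
    (∀ A : Matrix (Fin 5) (Fin 5) K,
      HomLie.IsMultStructureMatrix (HomLie.mu0 K 4 + HomLie.psi C 4 1 4) A ↔
        (∃ ρ : ℕ → ℕ → K,
          A = !![0, 0, 0, 0, 0;
               ρ 0 1, ρ 1 1, 0, 0, 0;
               ρ 0 2, ρ 1 2, 0, 0, 0;
               ρ 0 3, ρ 1 3, 0, 0, 0;
               ρ 0 4, ρ 1 4, -(ρ 1 1 * ρ 0 2) + ρ 1 2 * ρ 0 1, 0, 0]) ∨
        (∃ ρ : ℕ → ℕ → K,
          A = !![ρ 0 0, 0, 0, 0, 0;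
               ρ 0 1, 0, 0, 0, 0;
               ρ 0 2, ρ 1 2, 0, 0, 0;
               ρ 0 3, ρ 1 3, ρ 0 0 * ρ 1 2, 0, 0;
               ρ 0 4, ρ 1 4, ρ 0 1 * ρ 1 2 + ρ 0 0 * ρ 1 3, ρ 0 0 ^ 2 * ρ 1 2, 0]) ∨
        (∃ ρ : ℕ → ℕ → K,
          A = !![ρ 0 0, 0, 0, 0, 0;
               ρ 0 1, ρ 0 0 ^ 2, 0, 0, 0;
               ρ 0 2, ρ 1 2, ρ 0 0 ^ 3, 0, 0;
               ρ 0 3, ρ 1 3, ρ 0 0 * ρ 1 2, ρ 0 0 ^ 4, 0;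
               ρ 0 4, ρ 1 4, ρ 0 1 * ρ 1 2 + ρ 0 0 * ρ 1 3 - ρ 0 0 ^ 2 * ρ 0 2, ρ 0 0 ^ 2 * (ρ 0 0 * ρ 0 1 + ρ 1 2), ρ 0 0 ^ 5])) ∧
    -- dimension 6, bracket `μ₀`
    (∀ A : Matrix (Fin 6) (Fin 6) K,
      HomLie.IsMultStructureMatrix (HomLie.mu0 K 5) A ↔
        (∃ ρ : ℕ → ℕ → K, ρ 0 0 ≠ 0 ∧
          A = !![ρ 0 0, 0, 0, 0, 0, 0;
               ρ 0 1, ρ 2 2 / ρ 0 0, 0, 0, 0, 0;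
               ρ 0 2, ρ 2 3 / ρ 0 0, ρ 2 2, 0, 0, 0;
               ρ 0 3, ρ 2 4 / ρ 0 0, ρ 2 3, ρ 0 0 * ρ 2 2, 0, 0;
               ρ 0 4, ρ 1 4, ρ 2 4, ρ 2 3 * ρ 0 0, ρ 2 2 * ρ 0 0 ^ 2, 0;
               ρ 0 5, ρ 1 5, ρ 1 4 * ρ 0 0, ρ 2 4 * ρ 0 0, ρ 2 3 * ρ 0 0 ^ 2, ρ 0 0 ^ 3 * ρ 2 2]) ∨
        (∃ ρ : ℕ → ℕ → K,
          A = !![0, 0, 0, 0, 0, 0;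
               ρ 0 1, ρ 1 1, 0, 0, 0, 0;
               ρ 0 2, ρ 1 2, 0, 0, 0, 0;
               ρ 0 3, ρ 1 3, 0, 0, 0, 0;
               ρ 0 4, ρ 1 4, 0, 0, 0, 0;
               ρ 0 5, ρ 1 5, 0, 0, 0, 0])) ∧
    -- dimension 6, bracket `μ₀ + ψ_{1,4} + ψ_{2,5}`, case `C_1^1 = 0`; `s` is a square root of 5
    (C 1 1 = 0 → ∀ s : K, s ^ 2 = 5 → ∀ A : Matrix (Fin 6) (Fin 6) K,
      HomLie.IsMultStructureMatrix (HomLie.mu0 K 5 + HomLie.psi C 5 1 4 + HomLie.psi C 5 2 5) A ↔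
        (∃ ρ : ℕ → ℕ → K,
          A = !![0, 0, 0, 0, 0, 0;
               ρ 0 1, ρ 1 1, 0, 0, 0, 0;
               ρ 0 2, -(C 1 0 * ρ 1 1), 0, 0, 0, 0;
               ρ 0 3, ρ 1 3, 0, 0, 0, 0;
               ρ 0 4, ρ 1 4, -(ρ 1 1 * (C 1 0 * ρ 0 1 + ρ 0 2)), 0, 0, 0;
               ρ 0 5, ρ 1 5, ρ 1 3 * (C 1 0 * ρ 0 1 + ρ 0 2), 0, 0, 0]) ∨
        (∃ ρ : ℕ → ℕ → K, ρ 3 5 = ((3 + s) * ρ 1 3 - (4 + 2 * s) * ρ 0 2 - (4 + 2 * s) * (C 1 0 + 1) * ρ 0 1) / 2 ∧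
          ρ 2 5 = (-(3 + s) * ρ 0 3 + 2 * (C 1 0 * ρ 0 1 + ρ 0 2) * ρ 1 3 - (1 + s) * ρ 1 4) / 2 ∧
          A = !![-(1 + s) / 2, 0, 0, 0, 0, 0;
               ρ 0 1, 0, 0, 0, 0, 0;
               ρ 0 2, (3 + s) / 2, 0, 0, 0, 0;
               ρ 0 3, ρ 1 3, -2 - s, 0, 0, 0;
               ρ 0 4, ρ 1 4, ((3 + s) * ρ 0 1 - (1 + s) * ρ 1 3) / 2, (7 + 3 * s) / 2, 0, 0;
               ρ 0 5, ρ 1 5, ρ 2 5, ρ 3 5, -(11 + 5 * s) / 2, 0]) ∨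
        (∃ ρ : ℕ → ℕ → K, ρ 3 5 = ((3 - s) * ρ 1 3 - (4 - 2 * s) * ρ 0 2 - (4 - 2 * s) * (C 1 0 + 1) * ρ 0 1) / 2 ∧
          ρ 2 5 = (-(3 - s) * ρ 0 3 + 2 * (C 1 0 * ρ 0 1 + ρ 0 2) * ρ 1 3 - (1 - s) * ρ 1 4) / 2 ∧
          A = !![-(1 - s) / 2, 0, 0, 0, 0, 0;
               ρ 0 1, 0, 0, 0, 0, 0;
               ρ 0 2, (3 - s) / 2, 0, 0, 0, 0;
               ρ 0 3, ρ 1 3, -2 + s, 0, 0, 0;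
               ρ 0 4, ρ 1 4, ((3 - s) * ρ 0 1 - (1 - s) * ρ 1 3) / 2, (7 - 3 * s) / 2, 0, 0;
               ρ 0 5, ρ 1 5, ρ 2 5, ρ 3 5, -(11 - 5 * s) / 2, 0])) ∧
    -- dimension 6, bracket `μ₀ + ψ_{1,4} + ψ_{2,5}`, case `C_1^1 ≠ 0`; `s` is a square root of 5
    (C 1 1 ≠ 0 → ∀ s : K, s ^ 2 = 5 → ∀ A : Matrix (Fin 6) (Fin 6) K,
      HomLie.IsMultStructureMatrix (HomLie.mu0 K 5 + HomLie.psi C 5 1 4 + HomLie.psi C 5 2 5) A ↔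
        (∃ ρ : ℕ → ℕ → K,
          A = !![0, 0, 0, 0, 0, 0;
               ρ 0 1, 0, 0, 0, 0, 0;
               ρ 0 2, -(C 1 1 * ρ 0 1), 0, 0, 0, 0;
               ρ 0 3, ρ 1 3, 0, 0, 0, 0;
               ρ 0 4, ρ 1 4, -(C 1 1 * ρ 0 1 ^ 2), 0, 0, 0;
               ρ 0 5, ρ 1 5, (C 1 0 * ρ 0 1 + ρ 0 2) * ρ 1 3 + C 1 1 * ρ 0 1 * (ρ 0 3 - ρ 1 4), C 1 1 ^ 2 * ρ 0 1 ^ 3, 0, 0]) ∨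
        (∃ ρ : ℕ → ℕ → K,
          A = !![C 1 1 * ρ 0 1, 0, 0, 0, 0, 0;
               ρ 0 1, 0, 0, 0, 0, 0;
               ρ 0 2, 0, 0, 0, 0, 0;
               ρ 0 3, ρ 1 3, 0, 0, 0, 0;
               ρ 0 4, ρ 1 4, C 1 1 * ρ 0 1 * ρ 1 3, 0, 0, 0;
               ρ 0 5, ρ 1 5, (C 1 0 * ρ 0 1 + ρ 0 2) * ρ 1 3, 0, 0, 0]) ∨
        (∃ ρ : ℕ → ℕ → K, ρ 0 0 = -(1 + s) / 2 ∧
          ρ 1 2 = ρ 0 0 * (ρ 0 0 - C 1 1 * ρ 0 1) ∧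
          ρ 2 4 = ρ 0 0 * ρ 1 3 + ρ 0 1 * ρ 1 2 ∧
          A = !![ρ 0 0, 0, 0, 0, 0, 0;
               ρ 0 1, 0, 0, 0, 0, 0;
               ρ 0 2, ρ 1 2, 0, 0, 0, 0;
               ρ 0 3, ρ 1 3, ρ 0 0 * ρ 1 2, 0, 0, 0;
               ρ 0 4, ρ 1 4, ρ 2 4, ρ 0 0 ^ 2 * ρ 1 2, 0, 0;
               ρ 0 5, ρ 1 5, (ρ 0 0 - C 1 1 * ρ 0 1) * ρ 1 4 + (C 1 0 * ρ 0 1 + ρ 0 2) * ρ 1 3 - ρ 0 3 * ρ 1 2, (ρ 0 0 - C 1 1 * ρ 0 1) * ρ 2 4 + (C 1 0 * ρ 0 1 + ρ 0 2) * (ρ 0 0 * ρ 1 2), ρ 0 0 * ρ 1 2 ^ 2, 0]) ∨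
        (∃ ρ : ℕ → ℕ → K, ρ 0 0 = -(1 - s) / 2 ∧
          ρ 1 2 = ρ 0 0 * (ρ 0 0 - C 1 1 * ρ 0 1) ∧
          ρ 2 4 = ρ 0 0 * ρ 1 3 + ρ 0 1 * ρ 1 2 ∧
          A = !![ρ 0 0, 0, 0, 0, 0, 0;
               ρ 0 1, 0, 0, 0, 0, 0;
               ρ 0 2, ρ 1 2, 0, 0, 0, 0;
               ρ 0 3, ρ 1 3, ρ 0 0 * ρ 1 2, 0, 0, 0;
               ρ 0 4, ρ 1 4, ρ 2 4, ρ 0 0 ^ 2 * ρ 1 2, 0, 0;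
               ρ 0 5, ρ 1 5, (ρ 0 0 - C 1 1 * ρ 0 1) * ρ 1 4 + (C 1 0 * ρ 0 1 + ρ 0 2) * ρ 1 3 - ρ 0 3 * ρ 1 2, (ρ 0 0 - C 1 1 * ρ 0 1) * ρ 2 4 + (C 1 0 * ρ 0 1 + ρ 0 2) * (ρ 0 0 * ρ 1 2), ρ 0 0 * ρ 1 2 ^ 2, 0]) ∨
        (∃ ρ : ℕ → ℕ → K, ρ 0 0 ^ 2 = C 1 1 ∧
          ρ 0 1 = (1 - ρ 0 0) / ρ 0 0 ∧
          (1 + ρ 0 0) * ρ 1 2 = ρ 0 0 ^ 2 * (1 - C 1 0) ∧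
          ρ 2 4 = ρ 0 0 * ρ 1 3 + ρ 0 1 * ρ 1 2 - ρ 0 0 ^ 2 * ρ 0 2 ∧
          ρ 4 5 = ρ 0 0 * (ρ 1 2 ^ 2 + C 1 0 * ρ 0 0 ^ 2 * ρ 1 2 - ρ 0 0 ^ 3 * ρ 2 4 - ρ 0 0 ^ 2 * ρ 1 3) ∧
          ρ 4 5 = ρ 0 0 ^ 4 * (1 - ρ 0 0 + ρ 1 2 + C 1 0 * ρ 0 1 + ρ 0 2) ∧
          A = !![ρ 0 0, 0, 0, 0, 0, 0;
               ρ 0 1, ρ 0 0 ^ 2, 0, 0, 0, 0;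
               ρ 0 2, ρ 1 2, ρ 0 0 ^ 3, 0, 0, 0;
               ρ 0 3, ρ 1 3, ρ 0 0 * ρ 1 2, ρ 0 0 ^ 4, 0, 0;
               ρ 0 4, ρ 1 4, ρ 2 4, ρ 0 0 ^ 2 * (1 - ρ 0 0 + ρ 1 2), ρ 0 0 ^ 5, 0;
               ρ 0 5, ρ 1 5, ρ 0 0 ^ 2 * (ρ 1 4 - C 1 0 * ρ 0 3 + ρ 0 0 ^ 2 * ρ 0 4) + (C 1 0 * ρ 0 1 + ρ 0 2) * ρ 1 3 - ρ 0 3 * ρ 1 2, ρ 0 0 ^ 2 * ρ 2 4 + ρ 0 0 * ρ 1 2 * (C 1 0 * ρ 0 1 + ρ 0 2) - ρ 0 0 ^ 3 * ρ 0 3, ρ 4 5, ρ 0 0 ^ 7])) ∧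
    -- dimension 6, bracket `μ₀ + ψ_{1,4}`, case `C_1^0 ≠ 0, 1`
    (C 1 0 ≠ 0 → C 1 0 ≠ 1 → ∀ A : Matrix (Fin 6) (Fin 6) K,
      HomLie.IsMultStructureMatrix (HomLie.mu0 K 5 + HomLie.psi C 5 1 4) A ↔
        (∃ ρ : ℕ → ℕ → K,
          A = !![0, 0, 0, 0, 0, 0;
               ρ 0 1, 0, 0, 0, 0, 0;
               ρ 0 2, ρ 1 2, 0, 0, 0, 0;
               ρ 0 3, ρ 1 3, 0, 0, 0, 0;
               ρ 0 4, ρ 1 4, ρ 0 1 * ρ 1 2, 0, 0, 0;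
               ρ 0 5, ρ 1 5, C 1 0 * ρ 0 1 * ρ 1 3, 0, 0, 0]) ∨
        (∃ ρ : ℕ → ℕ → K, ρ 3 5 = ((1 + C 1 0) * ρ 0 1 ^ 2 + (-1 + C 1 0) * ρ 2 4) / ((-1 + C 1 0) * C 1 0) ∧
          ρ 2 5 = (-(ρ 0 3) + ρ 1 4 + ρ 1 3 * ρ 0 1 * C 1 0 ^ 2) / C 1 0 ∧
          ρ 0 2 = ((C 1 0 ^ 2 - C 1 0 ^ 3) * ρ 2 4 + C 1 0 * ρ 0 1 ^ 2 + C 1 0 ^ 2 * ρ 0 1 ^ 2 + C 1 0 ^ 2 * ρ 1 3 - C 1 0 * ρ 1 3) / (-1 + C 1 0) ∧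
          A = !![1 / C 1 0, 0, 0, 0, 0, 0;
               ρ 0 1, 1 / C 1 0 ^ 2, 0, 0, 0, 0;
               ρ 0 2, (1 + C 1 0) * ρ 0 1 / ((-1 + C 1 0) * C 1 0), 1 / C 1 0 ^ 3, 0, 0, 0;
               ρ 0 3, ρ 1 3, (1 + C 1 0) * ρ 0 1 / ((-1 + C 1 0) * C 1 0 ^ 2), 1 / C 1 0 ^ 4, 0, 0;
               ρ 0 4, ρ 1 4, ρ 2 4, 2 * ρ 0 1 / ((-1 + C 1 0) * C 1 0 ^ 2), 1 / C 1 0 ^ 5, 0;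
               ρ 0 5, ρ 1 5, ρ 2 5, ρ 3 5, (1 + C 1 0) * ρ 0 1 / ((-1 + C 1 0) * C 1 0 ^ 3), 1 / C 1 0 ^ 6])) ∧
    -- dimension 6, bracket `μ₀ + ψ_{1,4}`, case `C_1^0 = 1`
    (C 1 0 = 1 → ∀ A : Matrix (Fin 6) (Fin 6) K,
      HomLie.IsMultStructureMatrix (HomLie.mu0 K 5 + HomLie.psi C 5 1 4) A ↔
        (∃ ρ : ℕ → ℕ → K,
          A = !![0, 0, 0, 0, 0, 0;
               ρ 0 1, 0, 0, 0, 0, 0;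
               ρ 0 2, ρ 1 2, 0, 0, 0, 0;
               ρ 0 3, ρ 1 3, 0, 0, 0, 0;
               ρ 0 4, ρ 1 4, ρ 0 1 * ρ 1 2, 0, 0, 0;
               ρ 0 5, ρ 1 5, ρ 0 1 * ρ 1 3, 0, 0, 0]) ∨
        (∃ ρ : ℕ → ℕ → K,
          A = !![1, 0, 0, 0, 0, 0;
               0, 1, 0, 0, 0, 0;
               ρ 0 2, ρ 1 2, 1, 0, 0, 0;
               ρ 0 3, ρ 1 3, ρ 1 2, 1, 0, 0;
               ρ 0 4, ρ 1 4, ρ 1 3 - ρ 0 2, ρ 1 2, 1, 0;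
               ρ 0 5, ρ 1 5, ρ 1 4 - ρ 0 3, ρ 1 3 - ρ 0 2, ρ 1 2, 1])) ∧
    -- dimension 6, bracket `μ₀ + ψ_{1,5}`
    (∀ A : Matrix (Fin 6) (Fin 6) K,
      HomLie.IsMultStructureMatrix (HomLie.mu0 K 5 + HomLie.psi C 5 1 5) A ↔
        (∃ ρ : ℕ → ℕ → K, ρ 0 0 ≠ 0 ∧
          A = !![ρ 0 0, 0, 0, 0, 0, 0;
               ρ 0 1, 0, 0, 0, 0, 0;
               ρ 0 2, ρ 1 2, 0, 0, 0, 0;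
               ρ 0 3, ρ 2 4 / ρ 0 0, ρ 0 0 * ρ 1 2, 0, 0, 0;
               ρ 0 4, ρ 1 4, ρ 2 4, ρ 1 2 * ρ 0 0 ^ 2, 0, 0;
               ρ 0 5, ρ 1 5, ρ 1 2 * ρ 0 1 + ρ 1 4 * ρ 0 0, ρ 2 4 * ρ 0 0, ρ 1 2 * ρ 0 0 ^ 3, 0]) ∨
        (∃ ρ : ℕ → ℕ → K,
          A = !![0, 0, 0, 0, 0, 0;
               ρ 0 1, ρ 1 1, 0, 0, 0, 0;
               ρ 0 2, ρ 1 2, 0, 0, 0, 0;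
               ρ 0 3, ρ 1 3, 0, 0, 0, 0;
               ρ 0 4, ρ 1 4, 0, 0, 0, 0;
               ρ 0 5, ρ 1 5, -(ρ 1 1 * ρ 0 2) + ρ 0 1 * ρ 1 2, 0, 0, 0]) ∨
        (∃ ρ : ℕ → ℕ → K, ρ 0 0 ≠ 0 ∧
          A = !![ρ 0 0, 0, 0, 0, 0, 0;
               ρ 0 1, ρ 0 0 ^ 3, 0, 0, 0, 0;
               ρ 0 2, ρ 1 2, ρ 0 0 ^ 4, 0, 0, 0;
               ρ 0 3, ρ 2 4 / ρ 0 0, ρ 0 0 * ρ 1 2, ρ 0 0 ^ 5, 0, 0;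
               ρ 0 4, ρ 1 4, ρ 2 4, ρ 0 0 ^ 2 * ρ 1 2, ρ 0 0 ^ 6, 0;
               ρ 0 5, ρ 1 5, -(ρ 0 0 ^ 3 * ρ 0 2) + ρ 1 4 * ρ 0 0 + ρ 0 1 * ρ 1 2, ρ 0 0 * (ρ 0 0 ^ 3 * ρ 0 1 + ρ 2 4), ρ 0 0 ^ 3 * ρ 1 2, ρ 0 0 ^ 7]) ∨
        (∃ ρ : ℕ → ℕ → K,
          A = !![ρ 0 0, 0, 0, 0, 0, 0;
               ρ 0 1, ρ 0 0 ^ 3, 0, 0, 0, 0;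
               ρ 0 2, ρ 1 2, ρ 0 0 ^ 4, 0, 0, 0;
               ρ 0 3, 0, ρ 0 0 * ρ 1 2, ρ 0 0 ^ 5, 0, 0;
               ρ 0 4, ρ 1 4, 0, ρ 0 0 ^ 2 * ρ 1 2, ρ 0 0 ^ 6, 0;
               ρ 0 5, ρ 1 5, -(ρ 0 0 ^ 3 * ρ 0 2) + ρ 1 4 * ρ 0 0 + ρ 0 1 * ρ 1 2, ρ 0 0 ^ 4 * ρ 0 1, ρ 0 0 ^ 3 * ρ 1 2, ρ 0 0 ^ 7]) ∨
        (∃ ρ : ℕ → ℕ → K,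
          A = !![ρ 0 0, 0, 0, 0, 0, 0;
               ρ 0 1, 0, 0, 0, 0, 0;
               ρ 0 2, ρ 1 2, 0, 0, 0, 0;
               ρ 0 3, 0, ρ 0 0 * ρ 1 2, 0, 0, 0;
               ρ 0 4, ρ 1 4, 0, ρ 0 0 ^ 2 * ρ 1 2, 0, 0;
               ρ 0 5, ρ 1 5, ρ 1 4 * ρ 0 0 + ρ 0 1 * ρ 1 2, 0, ρ 0 0 ^ 3 * ρ 1 2, 0])) :=
  ⟨HomLie.isMultStructureMatrix_mu0_two, HomLie.isMultStructureMatrix_mu0_three,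
    HomLie.isMultStructureMatrix_mu0_four, HomLie.isMultStructureMatrix_mu0_four_add_psi_one_four hC00,
    HomLie.isMultStructureMatrix_mu0_five,
    fun hd _ hs => HomLie.isMultStructureMatrix_mu0_five_add_psi_add_psi_of_eq_zero hC00 hC hd hs,
    fun hd _ hs => HomLie.isMultStructureMatrix_mu0_five_add_psi_add_psi_of_ne_zero hC00 hC hd hs,
    fun h0 h1 => HomLie.isMultStructureMatrix_mu0_five_add_psi_one_four_of_ne hC00 h0 h1,
    fun hc => HomLie.isMultStructureMatrix_mu0_five_add_psi_one_four_of_eq_one hC00 hc,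
    HomLie.isMultStructureMatrix_mu0_five_add_psi_one_five hC00⟩
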